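/- **Theorem (random Sperner lemma).** Let $(\Omega,\mathcal F,P)$ be a probability space, $\mathbb K\in\{\mathbb R,\mathbb C\}$, and let $L^0(\mathcal F,\mathbb K)$ be the algebra of equivalence classes (modulo a.s. equality) of $\mathbb K$-valued random variables, $L^0(\mathcal F)=L^0(\mathcal F,\mathbb R)$, $L^0_+(\mathcal F)=\{\xi\in L^0(\mathcal F):\xi\ge 0\}$. A countable (or finite) family $\{a_m\}$ of classes modulo null sets of measurable sets is a partition of unity if the $a_m$ are pairwise disjoint with union $\Omega$ up to null sets (some $a_m$ may be null); $I_a$ denotes the class of the indicator function of $a$. Let $E$ be an $L^0(\mathcal F,\mathbb K)$-module that is regular: if $I_{a_k}x=I_{a_k}y$ for all $k\in\mathbb N$ and some partition of unity $\{a_k\}_{k\in\mathbb N}$, then $x=y$. For a sequence $(x_k)$ in $E$, $\sum_{k}I_{a_k}x_k$ denotes the (necessarily unique, if it exists) $x\in E$ with $I_{a_k}x=I_{a_k}x_k$ for all $k$, and $\sigma(H)$ denotes the set of all such countable concatenations of sequences in $H\subseteq E$. *Simplexes.* $\mathrm{Conv}_{L^0}(G)$ is the set of all finite sums $\sum_i\xi_ix_i$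 with $x_i\in G$, $\xi_i\in L^0_+(\mathcal F)$, $\sum_i\xi_i=1$. If $n\ge1$ and $x_1,\dots,x_n\in E$ are $L^0$-affinely independent (i.e. $x_2-x_1,\dots,x_n-x_1$ are linearly independent over $L^0(\mathcal F,\mathbb K)$), then $S=\mathrm{Conv}_{L^0}(\{x_1,\dots,x_n\})$, considered together with its vertexes $x_1,\dots,x_n$, is an $(n-1)$-dimensional $L^0$-simplex; its $L^0$-faces are the sets $\mathrm{Conv}_{L^0}(\{x_i:i\in I\})$, $\emptyset\ne I\subseteq\{1,\dots,n\}$, and its counterpart is the classical simplex $S'=\mathrm{Conv}(\{x_1,\dots,x_n\})$. *Subdivisions.* A finite family $\mathscr S$ of $(n-1)$-dimensional $L^0$-simplexes is an $L^0$-simplicial subdivision of $S$ if (1) $S=\sigma(\bigcup\mathscr S)$; (2) for all $S_1,S_2\in\mathscr S$, $S_1\cap S_2$ is empty or a common $L^0$-face of $S_1$ and $S_2$; (3) $\mathscr S'=\{G':G\in\mathscr S\}$ is a simplicial subdivision of $S'$, i.e. $S'=\bigcup\mathscr S'$ and any two members of $\mathscr S'$ intersect in the empty set or in a common face. *Labelings.*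 An $L^0$-extreme point of $G\subseteq E$ is an $h\in G$ such that $x=y=h$ whenever $x,y\in G$ and $\lambda x+(1-\lambda)y=h$ for some $\lambda\in L^0(\mathcal F)$ with $0<\lambda<1$ a.s.; $\mathrm{ext}_{L^0}(G)$ is the set of these points, and $\mathrm{ext}_{L^0}(\mathscr S)=\sigma(\bigcup_{G\in\mathscr S}\mathrm{ext}_{L^0}(G))$. A proper $L^0$-labeling function of $\mathscr S$ is a mapping $\phi$ from $\mathrm{ext}_{L^0}(\mathscr S)$ to the set $L^0(\mathcal F,\{1,\dots,n\})$ of classes of $\{1,\dots,n\}$-valued random variables that is $\sigma$-stable, $\phi(\sum_kI_{a_k}y_k)=\sum_kI_{a_k}\phi(y_k)$, and satisfies $P(\phi(y)=i,\ \lambda_i=0)=0$ for every $y=\sum_{i=1}^n\lambda_ix_i\in\mathrm{ext}_{L^0}(\mathscr S)$ (with $\lambda_i\in L^0_+(\mathcal F)$, $\sum_i\lambda_i=1$) and every $i\in\{1,\dots,n\}$. An $L^0$-simplex $\mathrm{Conv}_{L^0}(\{y_1,\dots,y_n\})$ with vertexes $y_j\in\mathrm{ext}_{L^0}(\mathscr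 S)$ is completely labeled by such a $\phi$ if $\{\phi(y_j):1\le j\le n\}=\{1,\dots,n\}$, where $1,\dots,n$ are identified with the classes of the constant random variables. *Claim.* Let $S=\mathrm{Conv}_{L^0}(\{x_1,\dots,x_n\})$ be an $(n-1)$-dimensional $L^0$-simplex in $E$, $\mathscr S$ an $L^0$-simplicial subdivision of $S$, and $\phi$ a proper $L^0$-labeling function of $\mathscr S$. Then there exist finitely many $L^0$-simplexes $S_m=\mathrm{Conv}_{L^0}(\{y^m_1,\dots,y^m_n\})\in\mathscr S$, $m=1,\dots,M$ (with a suitable enumeration $y^m_1,\dots,y^m_n$ of the vertexes of $S_m$), and a partition of unity $\{a_m\}_{m=1}^M$ such that $$\sum_{m=1}^MI_{a_m}S_m:=\Big\{\sum_{m=1}^MI_{a_m}z_m: z_m\in S_m\Big\}=\mathrm{Conv}_{L^0}\Big(\Big\{\sum_{m=1}^MI_{a_m}y^m_1,\dots,\sum_{m=1}^MI_{a_m}y^m_n\Big\}\Big)$$ is an $(n-1)$-dimensional $L^0$-simplex with vertexes $\sum_{m=1}^M I_{a_m}y^m_j$ ($j=1,\dots,n$), is completely labeled by $\phi$, and $$\phi\Big(\sum_{m=1}^MI_{a_m}y^m_j\Big)=j\qquad\text{for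 every } j\in\{1,\dots,n\}.$$ -/

import Mathlib

open MeasureTheory

namespace RandomSperner

noncomputable section

/-! ### The algebra `L⁰(𝓕, 𝕜)`, i.e. `Ω →ₘ[P] 𝕜`, and partitions of unity -/

/-- The commutative ring structure of the set of classes of random variables, extending the
additive group and multiplicative monoid structures provided by Mathlib. -/
instance instCommRingL0 {Ω : Type*} [MeasurableSpace Ω] {P : Measure Ω} {R : Type*}
    [TopologicalSpace R] [CommRing R] [IsTopologicalRing R] : CommRing (Ω →ₘ[P] R) :=
  { (AEEqFun.instAddCommGroup : AddCommGroup (Ω →ₘ[P] R)),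
    (AEEqFun.instCommMonoid : CommMonoid (Ω →ₘ[P] R)) with
    left_distrib := fun f g h => AEEqFun.induction_on₃ f g h fun f hf g hg h hh => by
      simp only [AEEqFun.mk_add_mk, AEEqFun.mk_mul_mk, mul_add]
    right_distrib := fun f g h => AEEqFun.induction_on₃ f g h fun f hf g hg h hh => by
      simp only [AEEqFun.mk_add_mk, AEEqFun.mk_mul_mk, add_mul]
    zero_mul := fun f => AEEqFun.induction_on f fun f hf => by
      rw [AEEqFun.zero_def, AEEqFun.mk_mul_mk, AEEqFun.mk_eq_mk]
      exact Filter.Eventually.of_forall fun ω => by simp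
    mul_zero := fun f => AEEqFun.induction_on f fun f hf => by
      rw [AEEqFun.zero_def, AEEqFun.mk_mul_mk, AEEqFun.mk_eq_mk]
      exact Filter.Eventually.of_forall fun ω => by simp }

/-- A partition of `Ω` into measurable sets indexed by `ι` (members may be empty). The classes
modulo null sets of its members form a partition of unity of the measure algebra, and every
countable partition of unity arises in this way. -/
structure MeasurablePartition (Ω : Type*) [MeasurableSpace Ω] (ι : Type*) where
  /-- the members of the partition -/
  sets : ι → Set Ω
  measurable : ∀ i, MeasurableSet (sets i)
  disjoint : Pairwise fun i j => Disjoint (sets i) (sets j)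
  cover : ⋃ i, sets i = Set.univ

/-- The class in `L⁰(𝓕, 𝕜)` of the indicator function of the `i`-th member of a partition. -/
def MeasurablePartition.ind {Ω : Type*} [MeasurableSpace Ω] {ι : Type*}
    (a : MeasurablePartition Ω ι) (P : Measure Ω) (𝕜 : Type*) [RCLike 𝕜] (i : ι) : Ω →ₘ[P] 𝕜 :=
  AEEqFun.mk ((a.sets i).indicator fun _ => (1 : 𝕜))
    (aestronglyMeasurable_const.indicator (a.measurable i))

/-- The inclusion of `L⁰(𝓕, ℝ)` into `L⁰(𝓕, 𝕜)`. -/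
def ofRealL0 {Ω : Type*} [MeasurableSpace Ω] {P : Measure Ω} (𝕜 : Type*) [RCLike 𝕜]
    (ξ : Ω →ₘ[P] ℝ) : Ω →ₘ[P] 𝕜 :=
  AEEqFun.comp (fun r : ℝ => (r : 𝕜)) RCLike.continuous_ofReal ξ

section Modules

variable {Ω : Type*} [MeasurableSpace Ω] (P : Measure Ω) (𝕜 : Type*) [RCLike 𝕜]
  {E : Type*} [AddCommGroup E] [Module (Ω →ₘ[P] 𝕜) E]

/-- Regularity of an `L⁰`-module: two elements that agree on every member of a countable
partition of unity are equal. -/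
def IsRegularModule (E : Type*) [AddCommGroup E] [Module (Ω →ₘ[P] 𝕜) E] : Prop :=
  ∀ x y : E, (∃ a : MeasurablePartition Ω ℕ, ∀ k, a.ind P 𝕜 k • x = a.ind P 𝕜 k • y) → x = y

/-- The `L⁰`-convex hull of a set. -/
def convL0 (G : Set E) : Set E :=
  {y | ∃ (k : ℕ) (x : Fin k → E) (ξ : Fin k → (Ω →ₘ[P] ℝ)),
    (∀ i, x i ∈ G) ∧ (∀ i, 0 ≤ ξ i) ∧ ∑ i, ξ i = 1 ∧ y = ∑ i, ofRealL0 𝕜 (ξ i) • x i}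

/-- `x` is the countable concatenation of the sequence `y` along the partition `a`. In a regular
module there is at most one such `x`. -/
def IsConcat (a : MeasurablePartition Ω ℕ) (y : ℕ → E) (x : E) : Prop :=
  ∀ k, a.ind P 𝕜 k • x = a.ind P 𝕜 k • y k

/-- The `σ`-stable hull: all countable concatenations of sequences in `H`. -/
def sigmaHull (H : Set E) : Set E :=
  {x | ∃ (a : MeasurablePartition Ω ℕ) (h : ℕ → E), (∀ k, h k ∈ H) ∧ IsConcat P 𝕜 a h x}

/-- `H` is an `L⁰`-extreme subset of `G`. -/
def IsExtremeL0 (G H : Set E) : Prop :=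
  H ⊆ G ∧ ∀ x ∈ G, ∀ y ∈ G, ∀ r : Ω →ₘ[P] ℝ, (∀ᵐ ω ∂P, 0 < r ω ∧ r ω < 1) →
    ofRealL0 𝕜 r • x + ofRealL0 𝕜 (1 - r) • y ∈ H → x ∈ H ∧ y ∈ H

/-- The set of `L⁰`-extreme points of `G`. -/
def extL0 (G : Set E) : Set E := {h | IsExtremeL0 P 𝕜 G {h}}

/-- The finite concatenation `∑ₘ I_{aₘ} Gₘ` of sets `Gₘ`. -/
def concatSets {M : ℕ} (a : MeasurablePartition Ω (Fin M)) (G : Fin M → Set E) : Set E :=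
  {x | ∃ z : Fin M → E, (∀ m, z m ∈ G m) ∧ x = ∑ m, a.ind P 𝕜 m • z m}

end Modules

/-! ### Classical simplexes and simplicial subdivisions in a real linear space -/

section Classical

variable {V : Type*} [AddCommGroup V] [Module ℝ V] {d : ℕ}

/-- `F` is a face of the simplex `T` (the convex hull of a nonempty set of vertices). -/
def IsFace (T : Affine.Simplex ℝ V d) (F : Set V) : Prop :=
  ∃ I : Set (Fin (d + 1)), I.Nonempty ∧ F = convexHull ℝ (T.points '' I)

/-- The family `𝒯` of `d`-dimensional simplexes is a simplicial subdivision of `S`. -/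
structure IsSimplicialSubdivision (S : Affine.Simplex ℝ V d) (𝒯 : Set (Affine.Simplex ℝ V d)) :
    Prop where
  finite : 𝒯.Finite
  cover : convexHull ℝ (Set.range S.points) = ⋃ T ∈ 𝒯, convexHull ℝ (Set.range T.points)
  inter : ∀ T₁ ∈ 𝒯, ∀ T₂ ∈ 𝒯,
    convexHull ℝ (Set.range T₁.points) ∩ convexHull ℝ (Set.range T₂.points) = ∅ ∨
    (IsFace T₁ (convexHull ℝ (Set.range T₁.points) ∩ convexHull ℝ (Set.range T₂.points)) ∧
      IsFace T₂ (convexHull ℝ (Set.range T₁.points) ∩ convexHull ℝ (Set.range T₂.points)))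

end Classical

/-! ### `L⁰`-simplexes, their subdivisions and labelings -/

section Simplexes

variable {Ω : Type*} [MeasurableSpace Ω] {P : Measure Ω} {𝕜 : Type*} [RCLike 𝕜]
  {E : Type*} [AddCommGroup E] [Module (Ω →ₘ[P] 𝕜) E] {d : ℕ}

/-- The point set `Conv_{L⁰} {x₁, …, xₙ}` (with `n = d + 1`) of the `d`-dimensional `L⁰`-simplex
with the `L⁰`-affinely independent vertexes `x₁, …, xₙ`. -/
def hullL0 (S : Affine.Simplex (Ω →ₘ[P] 𝕜) E d) : Set E := convL0 P 𝕜 (Set.range S.points)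

/-- `F` is an `L⁰`-face of the `L⁰`-simplex `S`. -/
def IsFaceL0 (S : Affine.Simplex (Ω →ₘ[P] 𝕜) E d) (F : Set E) : Prop :=
  ∃ I : Set (Fin (d + 1)), I.Nonempty ∧ F = convL0 P 𝕜 (S.points '' I)

/-- `L⁰`-affine independence implies affine independence over `ℝ`. -/
theorem affineIndependent_real [NeZero P] [Module ℝ E] [IsScalarTower ℝ (Ω →ₘ[P] 𝕜) E]
    (S : Affine.Simplex (Ω →ₘ[P] 𝕜) E d) : AffineIndependent ℝ S.points := by
  have h := S.independent
  rw [affineIndependent_iff_linearIndependent_vsub _ _ (0 : Fin (d + 1))] at h ⊢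
  refine h.restrict_scalars fun r s hrs => ?_
  have h1 : (r • (1 : Ω →ₘ[P] 𝕜)) = s • (1 : Ω →ₘ[P] 𝕜) := hrs
  rw [AEEqFun.one_def, AEEqFun.smul_mk, AEEqFun.smul_mk, AEEqFun.mk_eq_mk] at h1
  have : (ae P).NeBot := ae_neBot.2 (NeZero.ne P)
  obtain ⟨ω, hω⟩ := h1.exists
  have h2 : r • (1 : 𝕜) = s • (1 : 𝕜) := hω
  exact smul_left_injective ℝ (one_ne_zero : (1 : 𝕜) ≠ 0) h2

/-- The counterpart simplex of an `L⁰`-simplex: the classical simplex with the same vertexes. -/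
def counterpart [NeZero P] [Module ℝ E] [IsScalarTower ℝ (Ω →ₘ[P] 𝕜) E]
    (S : Affine.Simplex (Ω →ₘ[P] 𝕜) E d) : Affine.Simplex ℝ E d :=
  ⟨S.points, affineIndependent_real S⟩

/-- The family `𝒮` of `d`-dimensional `L⁰`-simplexes is an `L⁰`-simplicial subdivision of `S`. -/
structure IsSimplicialSubdivisionL0 [NeZero P] [Module ℝ E] [IsScalarTower ℝ (Ω →ₘ[P] 𝕜) E]
    (S : Affine.Simplex (Ω →ₘ[P] 𝕜) E d) (𝒮 : Set (Affine.Simplex (Ω →ₘ[P] 𝕜) E d)) :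
    Prop where
  finite : 𝒮.Finite
  cover : hullL0 S = sigmaHull P 𝕜 (⋃ T ∈ 𝒮, hullL0 T)
  inter : ∀ T₁ ∈ 𝒮, ∀ T₂ ∈ 𝒮, hullL0 T₁ ∩ hullL0 T₂ = ∅ ∨
    (IsFaceL0 T₁ (hullL0 T₁ ∩ hullL0 T₂) ∧ IsFaceL0 T₂ (hullL0 T₁ ∩ hullL0 T₂))
  counterpart : IsSimplicialSubdivision (counterpart S) (RandomSperner.counterpart '' 𝒮)

/-- The set of `L⁰`-extreme points of a family of `L⁰`-simplexes. -/
def extFamilyL0 (𝒮 : Set (Affine.Simplex (Ω →ₘ[P] 𝕜) E d)) : Set E :=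
  sigmaHull P 𝕜 (⋃ T ∈ 𝒮, extL0 P 𝕜 (hullL0 T))

/-- `φ` is an `L⁰`-labeling function of `𝒮`, i.e. a `σ`-stable mapping into
`L⁰(𝓕, {1, …, n})`; here `n = d + 1` and the label set is `Fin (d + 1)`. -/
def IsLabelingL0 (𝒮 : Set (Affine.Simplex (Ω →ₘ[P] 𝕜) E d))
    (φ : extFamilyL0 𝒮 → (Ω →ₘ[P] Fin (d + 1))) : Prop :=
  ∀ (a : MeasurablePartition Ω ℕ) (y : ℕ → extFamilyL0 𝒮) (x : extFamilyL0 𝒮),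
    IsConcat P 𝕜 a (fun k => (y k : E)) (x : E) →
    ∀ k, ∀ᵐ ω ∂P, ω ∈ a.sets k → φ x ω = φ (y k) ω

/-- `φ` is a proper `L⁰`-labeling function of the subdivision `𝒮` of `S`: the label `i` is almost
surely not used where the `i`-th barycentric coordinate vanishes. -/
structure IsProperLabelingL0 (S : Affine.Simplex (Ω →ₘ[P] 𝕜) E d)
    (𝒮 : Set (Affine.Simplex (Ω →ₘ[P] 𝕜) E d))
    (φ : extFamilyL0 𝒮 → (Ω →ₘ[P] Fin (d + 1))) : Prop where
  labeling : IsLabelingL0 𝒮 φ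
  proper : ∀ (y : extFamilyL0 𝒮) (l : Fin (d + 1) → (Ω →ₘ[P] ℝ)),
    (∀ i, 0 ≤ l i) → ∑ i, l i = 1 → (y : E) = ∑ i, ofRealL0 𝕜 (l i) • S.points i →
    ∀ i, ∀ᵐ ω ∂P, ¬ (φ y ω = i ∧ l i ω = 0)

/-- The `L⁰`-simplex `G` is completely labeled by `φ`: its vertexes are `L⁰`-extreme points of
`𝒮`, `φ` is proper, and the set of labels of the vertexes is the set of all constant labels. -/
def IsCompletelyLabeledL0 (S : Affine.Simplex (Ω →ₘ[P] 𝕜) E d)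
    (𝒮 : Set (Affine.Simplex (Ω →ₘ[P] 𝕜) E d))
    (φ : extFamilyL0 𝒮 → (Ω →ₘ[P] Fin (d + 1)))
    (G : Affine.Simplex (Ω →ₘ[P] 𝕜) E d) : Prop :=
  IsProperLabelingL0 S 𝒮 φ ∧
    ∃ h : ∀ j, G.points j ∈ extFamilyL0 𝒮,
      Set.range (fun j => φ ⟨G.points j, h j⟩) =
        Set.range fun i : Fin (d + 1) => (AEEqFun.const Ω i : Ω →ₘ[P] Fin (d + 1))

end Simplexes

end

end RandomSperner

open RandomSperner

/-! Fix `ω` and read every label at `ω`. The vertexes of the members of the subdivision lie in the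
counterpart simplex, so their barycentric coordinates are real constants, and properness says that
outside a null set the labels at `ω` form a proper classical labeling of the counterpart
subdivision. Finitely many vertexes are involved, so one null set suffices. Classical Sperner gives
a member whose labels at `ω` are distinct (`ae_exists_injective_label`). Only finitely many pairs
(member, ordering of its vertexes) occur; for each pair, the event that the `j`-th vertex has label
`j` for all `j` is measurable. These events cover almost all of `Ω`. Refining them to a partition
and concatenating the ordered vertexes along it gives the required simplex: σ-stability of the
labeling yields the labels, and concatenation preserves affine independence and commutes with convex
hulls.

Classical Sperner (`exists_injective_labeling`) is proved by a volume argument. In barycentric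
coordinates, let `h` be the piecewise linear map sending each vertex to the unit vector of its
label. Properness makes `h` preserve the faces of the orthant. For small `t > 0` the map `(1 - t) •
id + t • h` is a bijection of a corner simplex `D`, so the sum over the pieces of determinant times
volume equals `volume D`. This sum is a polynomial in `t`, hence constant, hence nonzero at `t = 1`:
some piece of `h` is nondegenerate, and its vertices have distinct labels
(`exists_det_ne_zero_of_piecewise_linear`). -/

open scoped NNReal
open Filter Topology

/-! ### Piecewise linear maps and the volume polynomial. -/

/-- A map that is piecewise linear with respect to a finite closed cover of a convex set is
Lipschitz on that set. -/
theorem exists_lipschitzOnWith_of_piecewise_linear {E F κ : Type*} [NormedAddCommGroup E]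
    [NormedSpace ℝ E] [NormedAddCommGroup F] [NormedSpace ℝ F] [Finite κ] {C : κ → Set E}
    (hC : ∀ k, IsClosed (C k)) {H : κ → E →L[ℝ] F} {h : E → F}
    (hh : ∀ k, ∀ x ∈ C k, h x = H k x) {Q : Set E} (hQ : Convex ℝ Q) (hcov : Q ⊆ ⋃ k, C k) :
    ∃ K : ℝ≥0, LipschitzOnWith K h Q := by
  cases nonempty_fintype κ
  have hcont : ContinuousOn h Q := by
    refine ContinuousOn.mono ?_ hcov
    refine (locallyFinite_of_finite C).continuousOn_iUnion hC fun k => ?_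
    exact (H k).continuous.continuousOn.congr fun x hx => hh k x hx
  refine ⟨∑ k, ‖H k‖₊, LipschitzOnWith.of_dist_le_mul fun y hy x hx => ?_⟩
  set K : ℝ≥0 := ∑ k, ‖H k‖₊ with hK
  have hKle : ∀ k, ‖H k‖ ≤ K := fun k => by
    have : ‖H k‖₊ ≤ K := 
      Finset.single_le_sum (f := fun k => ‖H k‖₊) (fun i _ => zero_le) (Finset.mem_univ k)
    exact_mod_cast this
  let γ : ℝ → E := fun s => x + s • (y - x)
  have hγ : Continuous γ := by fun_prop
  have hγQ : ∀ s ∈ Set.Icc (0 : ℝ) 1, γ s ∈ Q := fun s hs => hQ.add_smul_sub_mem hx hy hs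
  -- Continuous induction along the segment from `x` to `y`: `G` is the set of times up to which the
  -- bound holds. It is closed in `[0, 1]` and can always be prolonged to the right.
  let G : Set ℝ := {s | ‖h (γ s) - h x‖ ≤ K * (s * ‖y - x‖)}
  have hG : IsClosed (G ∩ Set.Icc 0 1) := by
    have h1 : ContinuousOn (fun s => h (γ s)) (Set.Icc 0 1) :=
      hcont.comp hγ.continuousOn hγQ
    have h2 : ContinuousOn (fun s => K * (s * ‖y - x‖) - ‖h (γ s) - h x‖) (Set.Icc 0 1) :=
      (by fun_prop : Continuous fun s : ℝ => K * (s * ‖y - x‖)).continuousOn.sub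
        (h1.sub continuousOn_const).norm
    have := h2.preimage_isClosed_of_isClosed isClosed_Icc (isClosed_Ici (a := (0 : ℝ)))
    convert this using 1
    ext s
    simp [G, and_comm]
  have h0 : (0 : ℝ) ∈ G := by simp [G, γ]
  have key : ∀ s ∈ G ∩ Set.Ico 0 1, ∀ b ∈ Set.Ioi s, (G ∩ Set.Ioc s b).Nonempty := by
    rintro s ⟨hs, hs0, hs1⟩ b hb
    -- By finiteness a single piece is visited at times arbitrarily close to `s` from the right.
    -- Being closed, it also contains `γ s`, so the increment of `h` between the two times is given
    -- by one linear map.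
    have hf : ∃ᶠ s' in 𝓝[>] s, ∃ k, γ s' ∈ C k := by
      refine Eventually.frequently ?_
      filter_upwards [Ioo_mem_nhdsGT hs1] with s' hs'
      simpa using hcov (hγQ s' ⟨hs0.trans hs'.1.le, hs'.2.le⟩)
    have hf' : ∃ k, ∃ᶠ s' in 𝓝[>] s, γ s' ∈ C k := by
      by_contra hcon
      push Not at hcon
      exact hf ((eventually_all.2 hcon).mono fun s' hs' => by simpa using hs')
    obtain ⟨k, hk⟩ := hf'
    have hsk : γ s ∈ C k := (hC k).mem_of_frequently_of_tendsto hk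
      (hγ.continuousAt.tendsto.mono_left nhdsWithin_le_nhds)
    obtain ⟨s', hs'k, hs'⟩ := (hk.and_eventually (Ioc_mem_nhdsGT hb)).exists
    refine ⟨s', ?_, hs'⟩
    have e1 : h (γ s') - h (γ s) = H k ((s' - s) • (y - x)) := by
      rw [hh k _ hs'k, hh k _ hsk, ← map_sub]
      congr 1
      simp only [γ]; module
    have e2 : ‖h (γ s') - h (γ s)‖ ≤ K * ((s' - s) * ‖y - x‖) := by
      rw [e1]
      refine ((H k).le_opNorm _).trans ?_
      rw [norm_smul, Real.norm_of_nonneg (sub_nonneg.2 hs'.1.le)]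
      exact mul_le_mul_of_nonneg_right (hKle k)
        (mul_nonneg (sub_nonneg.2 hs'.1.le) (norm_nonneg _))
    have e3 : ‖h (γ s) - h x‖ ≤ K * (s * ‖y - x‖) := hs
    calc ‖h (γ s') - h x‖ ≤ ‖h (γ s') - h (γ s)‖ + ‖h (γ s) - h x‖ := 
          norm_sub_le_norm_sub_add_norm_sub _ _ _
      _ ≤ K * ((s' - s) * ‖y - x‖) + K * (s * ‖y - x‖) := add_le_add e2 e3
      _ = K * (s' * ‖y - x‖) := by ring
  have := hG.Icc_subset_of_forall_exists_gt h0 key (Set.right_mem_Icc.2 zero_le_one)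
  simpa [G, γ, dist_eq_norm] using this

/-- The determinants of the affine path from the identity to `H` are the values of a
polynomial. -/
theorem exists_polynomial_eval_eq_det {ι : Type*} [Fintype ι] [DecidableEq ι]
    (H : (ι → ℝ) →ₗ[ℝ] (ι → ℝ)) :
    ∃ q : Polynomial ℝ, ∀ t : ℝ,
      q.eval t = LinearMap.det (LinearMap.id + t • (H - LinearMap.id)) := by
  let A := LinearMap.toMatrix' (H - LinearMap.id)
  refine ⟨((1 : Matrix ι ι (Polynomial ℝ)) +
    (Polynomial.X : Polynomial ℝ) • A.map Polynomial.C).det, fun t => ?_⟩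
  rw [← LinearMap.det_toMatrix' (LinearMap.id + t • (H - LinearMap.id)),
    ← Polynomial.coe_evalRingHom, RingHom.map_det]
  congr 1
  ext i j
  by_cases hij : i = j
  · subst hij
    simp [A, LinearMap.toMatrix'_apply]
  · simp [A, LinearMap.toMatrix'_apply, hij, mul_comm t]

/-- A map of the orthant onto itself that is piecewise linear with respect to a finite closed cover
with negligible overlaps, and that preserves the coordinate sum and all faces, is nondegenerate on
some member of the cover. -/
theorem exists_det_ne_zero_of_piecewise_linear {ι κ : Type*} [Fintype ι] [Finite κ]
    {C : κ → Set (ι → ℝ)} (hC : ∀ k, IsClosed (C k)) (hpos : ∀ k, ∀ x ∈ C k, 0 ≤ x)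
    (hcov : ∀ x, 0 ≤ x → ∃ k, x ∈ C k) {H : κ → (ι → ℝ) →ₗ[ℝ] (ι → ℝ)}
    (hcompat : ∀ k l, ∀ x ∈ C k, x ∈ C l → H k x = H l x)
    (hsum : ∀ k x, ∑ i, H k x i = ∑ i, x i) (hnn : ∀ k, ∀ x ∈ C k, 0 ≤ H k x)
    (hface : ∀ k, ∀ x ∈ C k, ∀ i, x i = 0 → H k x i = 0)
    (hnull : ∀ k l, k ≠ l → volume (C k ∩ C l) = 0) : ∃ k, LinearMap.det (H k) ≠ 0 := by
  classical
  cases nonempty_fintype κ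
  have : Nonempty κ := ⟨(hcov 0 le_rfl).choose⟩
  choose! κ' hκ' using hcov
  -- `r` retracts the whole space onto the orthant. Composing with it makes the perturbation `u`
  -- below globally Lipschitz, as the contraction argument requires.
  let r : (ι → ℝ) → (ι → ℝ) := fun x => x ⊔ 0
  have hr0 : ∀ x, 0 ≤ r x := fun x => le_sup_right
  have hr : ∀ x, 0 ≤ x → r x = x := fun x hx => sup_eq_left.2 hx
  have hrL : ∀ x y, ‖r x - r y‖ ≤ ‖x - y‖ := fun x y => by
    refine (pi_norm_le_iff_of_nonneg (norm_nonneg _)).2 fun i => ?_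
    refine le_trans ?_ (norm_le_pi_norm (x - y) i)
    simpa [r, Real.norm_eq_abs] using abs_max_sub_max_le_abs (x i) (y i) 0
  let h : (ι → ℝ) → (ι → ℝ) := fun x => H (κ' (r x)) (r x)
  have hh : ∀ k, ∀ x ∈ C k, h x = H k x := fun k x hx => by
    have hx0 := hpos k x hx
    simp only [h, hr x hx0]
    exact hcompat _ _ x (hκ' x hx0) hx
  obtain ⟨K, hK⟩ : ∃ K : ℝ≥0, LipschitzOnWith K h (Set.Ici 0) :=
    exists_lipschitzOnWith_of_piecewise_linear (H := fun k => (H k).toContinuousLinearMap) hC hh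
      (convex_Ici 0) fun x hx => Set.mem_iUnion.2 ⟨_, hκ' x hx⟩
  let u : (ι → ℝ) → (ι → ℝ) := fun x => h x - r x
  have huL : ∀ x y, ‖u x - u y‖ ≤ (K + 1) * ‖x - y‖ := fun x y => by
    have e1 : ‖h x - h y‖ ≤ K * ‖r x - r y‖ := by
      have := hK.dist_le_mul _ (hr0 x) _ (hr0 y)
      simpa only [dist_eq_norm, h, hr _ (hr0 _)] using this
    calc ‖u x - u y‖ = ‖(h x - h y) - (r x - r y)‖ := by congr 1; simp only [u]; abel
      _ ≤ ‖h x - h y‖ + ‖r x - r y‖ := norm_sub_le _ _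
      _ ≤ K * ‖r x - r y‖ + ‖r x - r y‖ := by gcongr
      _ = (K + 1) * ‖r x - r y‖ := by ring
      _ ≤ (K + 1) * ‖x - y‖ := by gcongr; exact hrL x y
  let F : ℝ → (ι → ℝ) → (ι → ℝ) := fun t x => x + t • u x
  let L : κ → ℝ → (ι → ℝ) →ₗ[ℝ] (ι → ℝ) := fun k t => LinearMap.id + t • (H k - LinearMap.id)
  have hFL : ∀ k t, ∀ x ∈ C k, F t x = L k t x := fun k t x hx => by
    simp [F, L, u, hh k x hx, hr x (hpos k x hx)]
  -- Truncation of the orthant to finite volume; it is compatible with `F t`, which preserves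
  -- coordinate sums on the orthant.
  let D : Set (ι → ℝ) := {x | 0 ≤ x ∧ ∑ i, x i ≤ 1}
  have hhsum : ∀ x, 0 ≤ x → ∑ i, h x i = ∑ i, x i := fun x hx => by
    rw [hh _ x (hκ' x hx), hsum]
  have hFsum : ∀ t x, 0 ≤ x → ∑ i, F t x i = ∑ i, x i := fun t x hx => by
    simp [F, u, hr x hx, Finset.sum_add_distrib, ← Finset.mul_sum, hhsum x hx]
  have hsmall : ∀ᶠ t : ℝ in 𝓝[>] 0, 0 < t ∧ t ≤ 1 ∧ t * ((K : ℝ) + 1) < 1 := by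
    have h1 : ∀ᶠ t in 𝓝[>] (0 : ℝ), t * ((K : ℝ) + 1) < 1 := by
      refine Filter.Eventually.filter_mono nhdsWithin_le_nhds ?_
      exact (by fun_prop : Continuous fun t : ℝ => t * ((K : ℝ) + 1)).continuousAt.eventually_lt
        continuousAt_const (by simp)
    filter_upwards [h1, Ioc_mem_nhdsGT (zero_lt_one' ℝ)] with t h1 h2
    exact ⟨h2.1, h2.2, h1⟩
  have hinj : ∀ t : ℝ, 0 < t → t * ((K : ℝ) + 1) < 1 → Function.Injective (F t) := by
    intro t ht0 ht1 x y hxy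
    have e : x - y = t • (u y - u x) := by
      have : x + t • u x = y + t • u y := hxy
      rw [smul_sub, sub_eq_sub_iff_add_eq_add, this, add_comm]
    have e2 : ‖x - y‖ ≤ t * (K + 1) * ‖x - y‖ := by
      calc ‖x - y‖ = t * ‖u x - u y‖ := by
            rw [e, norm_smul, Real.norm_of_nonneg ht0.le, norm_sub_rev]
        _ ≤ t * ((K + 1) * ‖x - y‖) := by gcongr; exact huL x y
        _ = _ := by ring
    have : ‖x - y‖ = 0 := by nlinarith [norm_nonneg (x - y)]
    exact sub_eq_zero.1 (norm_eq_zero.1 this)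
  have himage : ∀ t : ℝ, 0 < t → t ≤ 1 → t * ((K : ℝ) + 1) < 1 → F t '' D = D := by
    intro t ht0 ht1 htK
    refine Set.Subset.antisymm ?_ fun y hy => ?_
    · rintro _ ⟨x, ⟨hx0, hx1⟩, rfl⟩
      refine ⟨?_, by rw [hFsum t x hx0]; exact hx1⟩
      have e : F t x = (1 - t) • x + t • h x := by
        simp only [F, u, hr x hx0]; module
      rw [e]
      have : 0 ≤ h x := by rw [hh _ x (hκ' x hx0)]; exact hnn _ x (hκ' x hx0)
      exact add_nonneg (smul_nonneg (by linarith) hx0) (smul_nonneg ht0.le this)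
    -- Solving `F t x = y` means finding a fixed point of `x ↦ y - t • u x`.
    · have hc : ContractingWith (t * (K + 1)).toNNReal fun x => y - t • u x := by
        refine ⟨by simpa using htK, LipschitzWith.of_dist_le_mul fun a b => ?_⟩
        rw [dist_eq_norm, dist_eq_norm]
        calc ‖(y - t • u a) - (y - t • u b)‖ = ‖t • (u b - u a)‖ := by congr 1; module
          _ = t * ‖u a - u b‖ := by
            rw [norm_smul, Real.norm_of_nonneg ht0.le, norm_sub_rev]
          _ ≤ t * ((K + 1) * ‖a - b‖) := by gcongr; exact huL a b
          _ = _ := by rw [Real.coe_toNNReal _ (by positivity)]; ring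
      set x := hc.fixedPoint with hx
      have hfix : y - t • u x = x := hc.fixedPoint_isFixedPt
      have hFx : F t x = y := by
        simp only [F]; nth_rewrite 1 [← hfix]; exact sub_add_cancel _ _
      -- A negative coordinate of `x` is zero in `r x`, hence zero in `h x` by the face condition.
      -- Then `u x` vanishes there and `y i = x i < 0`, which is impossible.
      have hx0 : 0 ≤ x := by
        intro i
        by_contra hi
        have hi : x i < 0 := not_le.1 hi
        have hri : r x i = 0 := by simpa [r] using hi.le
        have hhi : h x i = 0 := hface _ _ (hκ' _ (hr0 x)) i hri
        have : y i = x i := by rw [← hFx]; simp [F, u, hri, hhi]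
        exact absurd (hy.1 i) (by rw [this]; exact not_le.2 hi)
      exact ⟨x, ⟨hx0, by rw [← hFsum t x hx0, hFx]; exact hy.2⟩, hFx⟩
  have hDclosed : IsClosed D := isClosed_Ici.inter
    (isClosed_le (by fun_prop : Continuous fun x : ι → ℝ => ∑ i, x i) continuous_const)
  have hDcomp : IsCompact D := by
    refine (isCompact_Icc (a := (0 : ι → ℝ)) (b := 1)).of_isClosed_subset hDclosed ?_
    rintro x ⟨hx0, hx1⟩
    exact ⟨hx0, fun i => (Finset.single_le_sum (fun j _ => hx0 j) (Finset.mem_univ i)).trans hx1⟩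
  have hDpos : 0 < volume D := by
    let U : Set (ι → ℝ) := {x | (∀ i, 0 < x i) ∧ ∑ i, x i < 1}
    have hU : IsOpen U := by
      refine IsOpen.inter ?_ (isOpen_lt (by fun_prop : Continuous fun x : ι → ℝ => ∑ i, x i)
        continuous_const)
      have : {x : ι → ℝ | ∀ i, 0 < x i} = ⋂ i, {x | 0 < x i} := by ext; simp
      change IsOpen {x : ι → ℝ | ∀ i, 0 < x i}
      rw [this]
      exact isOpen_iInter_of_finite fun i => isOpen_lt continuous_const (continuous_apply i)
    have hne : U.Nonempty := by
      refine ⟨fun _ => 1 / (Fintype.card ι + 1), fun i => by positivity, ?_⟩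
      simp only [Finset.sum_const, Finset.card_univ, nsmul_eq_mul]
      rw [mul_one_div, div_lt_one (by positivity)]
      linarith
    exact (hU.measure_pos volume hne).trans_le
      (measure_mono fun x hx => ⟨fun i => (hx.1 i).le, hx.2.le⟩)
  have hvol : ∀ t : ℝ, 0 < t → t ≤ 1 → t * ((K : ℝ) + 1) < 1 →
      volume D = ∑ k, ENNReal.ofReal |LinearMap.det (L k t)| * volume (D ∩ C k) := by
    intro t ht0 ht1 htK
    have e1 : D = ⋃ k, L k t '' (D ∩ C k) := by
      calc D = F t '' D := (himage t ht0 ht1 htK).symm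
        _ = F t '' ⋃ k, D ∩ C k := by
          congr 1
          rw [← Set.inter_iUnion, eq_comm, Set.inter_eq_left]
          exact fun x hx => Set.mem_iUnion.2 ⟨_, hκ' x hx.1⟩
        _ = _ := by
          rw [Set.image_iUnion]
          exact Set.iUnion_congr fun k => Set.image_congr fun x hx => hFL k t x hx.2
    -- Injectivity of `F t` confines the overlap of two images to the image of the overlap of the
    -- pieces.
    have e2 : Pairwise (Function.onFun (AEDisjoint volume) fun k => L k t '' (D ∩ C k)) := by
      intro k l hkl
      have hsub : L k t '' (D ∩ C k) ∩ L l t '' (D ∩ C l) ⊆ L k t '' (C k ∩ C l) := by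
        rintro _ ⟨⟨x, hx, rfl⟩, x', hx', hxx'⟩
        rw [← hFL l t x' hx'.2, ← hFL k t x hx.2] at hxx'
        obtain rfl := hinj t ht0 htK hxx'
        exact ⟨x', ⟨hx.2, hx'.2⟩, rfl⟩
      refine measure_mono_null hsub ?_
      rw [Measure.addHaar_image_linearMap, hnull k l hkl, mul_zero]
    have e3 : ∀ k, NullMeasurableSet (L k t '' (D ∩ C k)) volume := fun k =>
      ((hDcomp.inter_right (hC k)).image
        (L k t).continuous_of_finiteDimensional).measurableSet.nullMeasurableSet
    conv_lhs => rw [e1]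
    rw [measure_iUnion₀ e2 e3, tsum_fintype]
    exact Finset.sum_congr rfl fun k _ => Measure.addHaar_image_linearMap _ _ _
  choose q hq using fun k => exists_polynomial_eval_eq_det (H k)
  let p : Polynomial ℝ := ∑ k, Polynomial.C (volume (D ∩ C k)).toReal * q k
  have hp : ∀ t, p.eval t = ∑ k, (volume (D ∩ C k)).toReal * LinearMap.det (L k t) := fun t => by
    simp [p, Polynomial.eval_finsetSum, hq, L]
  -- Near `t = 0` the maps are close to the identity, so the absolute values disappear and the
  -- volume sum is a polynomial.
  have hdet : ∀ᶠ t in 𝓝[>] (0 : ℝ), ∀ k, 0 < LinearMap.det (L k t) := by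
    refine eventually_all.2 fun k => Filter.Eventually.filter_mono nhdsWithin_le_nhds ?_
    have hc : ContinuousAt (fun t => LinearMap.det (L k t)) 0 := by
      have : (fun t => LinearMap.det (L k t)) = fun t => (q k).eval t :=
        funext fun t => (hq k t).symm
      rw [this]
      exact (q k).continuous.continuousAt
    exact continuousAt_const.eventually_lt hc (by simp [L])
  have hfin : ∀ k, volume (D ∩ C k) ≠ ⊤ := fun k =>
    ((measure_mono Set.inter_subset_left).trans_lt hDcomp.measure_lt_top).ne
  have hpD : ∀ᶠ t in 𝓝[>] (0 : ℝ), p.eval t = (volume D).toReal := by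
    filter_upwards [hsmall, hdet] with t ht hdet
    rw [hp, hvol t ht.1 ht.2.1 ht.2.2, ENNReal.toReal_sum fun k _ =>
      ENNReal.mul_ne_top ENNReal.ofReal_ne_top (hfin k)]
    refine Finset.sum_congr rfl fun k _ => ?_
    rw [ENNReal.toReal_mul, abs_of_pos (hdet k), ENNReal.toReal_ofReal (hdet k).le, mul_comm]
  have hpconst : p = Polynomial.C (volume D).toReal := by
    refine Polynomial.eq_of_infinite_eval_eq _ _ ?_
    obtain ⟨b, hb, hsub⟩ := mem_nhdsGT_iff_exists_Ioo_subset.1 hpD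
    refine (Set.Ioo_infinite hb).mono fun t ht => ?_
    simpa using hsub ht
  by_contra hcon
  push Not at hcon
  -- At `t = 1` the map `L k t` is `H k` itself.
  have h1 : p.eval 1 = 0 := by
    rw [hp]
    exact Finset.sum_eq_zero fun k _ => by simp [L, hcon k]
  rw [hpconst, Polynomial.eval_C] at h1
  exact (ENNReal.toReal_pos hDpos.ne' hDcomp.measure_lt_top.ne).ne' h1

/-! ### Barycentric coordinates and common faces. -/

/-- Barycentric coordinates with respect to affinely independent vectors are unique. -/
theorem AffineIndependent.eq_of_sum_smul_eq {R V ι : Type*} [Ring R] [AddCommGroup V] [Module R V]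
    [Fintype ι] {p : ι → V} (hp : AffineIndependent R p) {a b : ι → R}
    (h1 : ∑ i, a i = ∑ i, b i) (h2 : ∑ i, a i • p i = ∑ i, b i • p i) : a = b := by
  funext i
  refine sub_eq_zero.1 (affineIndependent_iff.1 hp Finset.univ (fun i => a i - b i) ?_ ?_ i
    (Finset.mem_univ i))
  · rw [Finset.sum_sub_distrib, h1, sub_self]
  · simp only [sub_smul, Finset.sum_sub_distrib, h2, sub_self]

/-- Weights that vanish off `I` keep one index type for all faces, so they can be compared directly
with the coordinates in the full simplex. -/
theorem exists_weights_of_mem_convexHull_image {V ι : Type*} [AddCommGroup V] [Module ℝ V]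
    [Fintype ι] {p : ι → V} {I : Set ι} {x : V} (hx : x ∈ convexHull ℝ (p '' I)) :
    ∃ w : ι → ℝ, 0 ≤ w ∧ ∑ i, w i = 1 ∧ (∀ i ∉ I, w i = 0) ∧ ∑ i, w i • p i = x := by
  classical
  have : convexHull ℝ (p '' I) ⊆
      {x | ∃ w : ι → ℝ, 0 ≤ w ∧ ∑ i, w i = 1 ∧ (∀ i ∉ I, w i = 0) ∧ ∑ i, w i • p i = x} := by
    refine convexHull_min ?_ ?_
    · rintro _ ⟨i, hi, rfl⟩
      refine ⟨Pi.single i 1, Pi.single_nonneg.2 zero_le_one, by simp, fun j hj => ?_, ?_⟩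
      · exact Pi.single_eq_of_ne (fun h : j = i => hj (h ▸ hi)) _
      · simp [Pi.single_apply, ite_smul]
    · rintro _ ⟨v, hv0, hv1, hvI, rfl⟩ _ ⟨w, hw0, hw1, hwI, rfl⟩ s t hs ht hst
      refine ⟨s • v + t • w, add_nonneg (smul_nonneg hs hv0) (smul_nonneg ht hw0), ?_, ?_, ?_⟩
      · simp [Finset.sum_add_distrib, ← Finset.mul_sum, hv1, hw1, hst]
      · intro i hi
        simp [hvI i hi, hwI i hi]
      · simp [add_smul, Finset.sum_add_distrib, mul_smul, Finset.smul_sum]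
  exact this hx

theorem exists_weights_of_mem_convexHull_range {V ι : Type*} [AddCommGroup V] [Module ℝ V]
    [Fintype ι] {p : ι → V} {x : V} (hx : x ∈ convexHull ℝ (Set.range p)) :
    ∃ w : ι → ℝ, 0 ≤ w ∧ ∑ i, w i = 1 ∧ ∑ i, w i • p i = x := by
  rw [← Set.image_univ] at hx
  obtain ⟨w, h0, h1, -, h2⟩ := exists_weights_of_mem_convexHull_image hx
  exact ⟨w, h0, h1, h2⟩

/-- The vertices of a simplex are determined by its convex hull. -/
theorem AffineIndependent.image_subset_of_convexHull_eq {V ι κ : Type*} [AddCommGroup V]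
    [Module ℝ V] [Fintype ι] [Fintype κ] {p : ι → V} {q : κ → V} (hp : AffineIndependent ℝ p)
    {I : Set ι} {J : Set κ} (h : convexHull ℝ (p '' I) = convexHull ℝ (q '' J)) :
    p '' I ⊆ q '' J := by
  classical
  rintro _ ⟨i, hi, rfl⟩
  have hiJ : p i ∈ convexHull ℝ (q '' J) := h ▸ subset_convexHull ℝ _ (Set.mem_image_of_mem p hi)
  obtain ⟨b, hb0, hb1, hbJ, hb⟩ := exists_weights_of_mem_convexHull_image hiJ
  have hc : ∀ j ∈ J, ∃ w : ι → ℝ, 0 ≤ w ∧ ∑ i, w i = 1 ∧ ∑ i, w i • p i = q j := fun j hj => by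
    have : q j ∈ convexHull ℝ (p '' I) := h ▸ subset_convexHull ℝ _ (Set.mem_image_of_mem q hj)
    obtain ⟨w, h0, h1, -, h2⟩ := exists_weights_of_mem_convexHull_image this
    exact ⟨w, h0, h1, h2⟩
  choose! c hc0 hc1 hc using hc
  have hJ : ∀ j, b j ≠ 0 → j ∈ J := fun j hj => by_contra fun hjJ => hj (hbJ j hjJ)
  -- Expanding `p i` through the `q j`, and these through the `p k`, gives the coordinates of a
  -- vertex. All terms are nonnegative, so any `q j` that carries weight has no component off `i`
  -- and equals `p i`.
  have key : (fun k => ∑ j, b j * c j k) = Pi.single i 1 := by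
    refine hp.eq_of_sum_smul_eq ?_ ?_
    · rw [Finset.sum_comm]
      simp only [← Finset.mul_sum]
      rw [Finset.sum_congr rfl (g := b), hb1]
      · simp
      · intro j _
        by_cases hj : b j = 0
        · simp [hj]
        · rw [hc1 j (hJ j hj), mul_one]
    · simp only [Finset.sum_smul, mul_smul]
      rw [Finset.sum_comm]
      simp only [← Finset.smul_sum]
      rw [Finset.sum_congr rfl (g := fun j => b j • q j), hb]
      · simp [Pi.single_apply, ite_smul]
      · intro j _
        by_cases hj : b j = 0
        · simp [hj]
        · rw [hc j (hJ j hj)]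
  obtain ⟨j, hj⟩ : ∃ j, b j ≠ 0 := by
    by_contra hcon
    push Not at hcon
    simp [hcon] at hb1
  refine ⟨j, hJ j hj, ?_⟩
  have hck : ∀ k, k ≠ i → c j k = 0 := fun k hk => by
    have h1 : ∑ j, b j * c j k = 0 := by
      have := congrFun key k
      simpa [hk] using this
    rw [Finset.sum_eq_zero_iff_of_nonneg] at h1
    · exact (mul_eq_zero.1 (h1 j (Finset.mem_univ j))).resolve_left hj
    · intro l _
      by_cases hl : b l = 0
      · simp [hl]
      · exact mul_nonneg (hb0 l) (hc0 l (hJ l hl) k)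
  have hci : c j i = 1 := by
    rw [← hc1 j (hJ j hj)]
    exact (Finset.sum_eq_single i (fun k _ hk => hck k hk) (by simp)).symm
  rw [← hc j (hJ j hj), Finset.sum_eq_single i (fun k _ hk => by rw [hck k hk, zero_smul])
    (by simp), hci, one_smul]

/-- Weights on two families with the same barycenter agree if the vectors carrying the first
weight belong to the second family. -/
theorem AffineIndependent.sum_smul_comp_eq {V W ι κ : Type*} [AddCommGroup V] [Module ℝ V]
    [AddCommGroup W] [Module ℝ W] [Fintype ι] [Fintype κ] {p : ι → V} {q : κ → V}
    (hq : AffineIndependent ℝ q) {a : ι → ℝ} {b : κ → ℝ}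
    (ha : ∀ i, a i ≠ 0 → p i ∈ Set.range q) (h1 : ∑ i, a i = ∑ j, b j)
    (h2 : ∑ i, a i • p i = ∑ j, b j • q j) (g : V → W) :
    ∑ i, a i • g (p i) = ∑ j, b j • g (q j) := by
  classical
  let a' : κ → ℝ := fun j => ∑ i, if q j = p i then a i else 0
  -- Bundling mass, barycenter and value of `g` lets one regrouping of the weights along coinciding
  -- points establish all three identities.
  let f : V → ℝ × V × W := fun v => (1, v, g v)
  have key : ∑ j, a' j • f (q j) = ∑ i, a i • f (p i) := by
    simp only [a', Finset.sum_smul]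
    rw [Finset.sum_comm]
    refine Finset.sum_congr rfl fun i _ => ?_
    by_cases hi : a i = 0
    · simp [hi]
    · obtain ⟨j, hj⟩ := ha i hi
      rw [Finset.sum_eq_single j]
      · simp [hj]
      · intro l _ hl
        rw [if_neg, zero_smul]
        exact fun h => hl (hq.injective (h.trans hj.symm))
      · simp
  simp only [f, Prod.smul_mk, smul_eq_mul, mul_one, Prod.ext_iff, Prod.fst_sum, Prod.snd_sum]
    at key
  obtain ⟨e1, e2, e3⟩ := key
  rw [← e3, hq.eq_of_sum_smul_eq (e1.trans h1) (e2.trans h2)]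

/-- If two simplexes meet in a common face, then a common point is a combination of common
vertices. Here the weights need not be normalized. -/
theorem mem_range_of_sum_smul_eq {V : Type*} [AddCommGroup V] [Module ℝ V] {d : ℕ}
    {T T' : Affine.Simplex ℝ V d}
    (h : convexHull ℝ (Set.range T.points) ∩ convexHull ℝ (Set.range T'.points) = ∅ ∨
      (IsFace T (convexHull ℝ (Set.range T.points) ∩ convexHull ℝ (Set.range T'.points)) ∧
        IsFace T' (convexHull ℝ (Set.range T.points) ∩ convexHull ℝ (Set.range T'.points))))
    {a b : Fin (d + 1) → ℝ} (ha : 0 ≤ a) (hb : 0 ≤ b) (h1 : ∑ i, a i = ∑ i, b i)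
    (h2 : ∑ i, a i • T.points i = ∑ i, b i • T'.points i) (i : Fin (d + 1)) (hi : a i ≠ 0) :
    T.points i ∈ Set.range T'.points := by
  set s := ∑ i, a i with hs
  have hs0 : 0 < s := Finset.sum_pos' (fun j _ => ha j)
    ⟨i, Finset.mem_univ i, lt_of_le_of_ne (ha i) hi.symm⟩
  have hmem : ∀ (U : Affine.Simplex ℝ V d) (c : Fin (d + 1) → ℝ), 0 ≤ c → ∑ i, c i = s →
      s⁻¹ • ∑ i, c i • U.points i ∈ convexHull ℝ (Set.range U.points) := by
    intro U c hc hcs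
    refine mem_convexHull_of_exists_fintype (fun i => s⁻¹ * c i) U.points
      (fun i => mul_nonneg (inv_nonneg.2 hs0.le) (hc i)) ?_ (fun i => Set.mem_range_self i) ?_
    · rw [← Finset.mul_sum, hcs, inv_mul_cancel₀ hs0.ne']
    · simp only [mul_smul, Finset.smul_sum]
  have hx : s⁻¹ • ∑ i, a i • T.points i ∈
      convexHull ℝ (Set.range T.points) ∩ convexHull ℝ (Set.range T'.points) :=
    ⟨hmem T a ha rfl, by rw [h2]; exact hmem T' b hb h1.symm⟩
  rcases h with h | ⟨⟨I, -, hI⟩, ⟨J, -, hJ⟩⟩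
  · rw [h] at hx
    exact hx.elim
  -- The intersection is spanned by `I` in one simplex and by `J` in the other, so the vertices in
  -- `I` are also vertices of `T'`. By uniqueness of coordinates, `a` is supported in `I`.
  · have hsub := T.independent.image_subset_of_convexHull_eq (hI.symm.trans hJ)
    rw [hI] at hx
    obtain ⟨w, -, hw1, hwI, hw⟩ := exists_weights_of_mem_convexHull_image hx
    have hwa : w = fun i => s⁻¹ * a i := by
      refine T.independent.eq_of_sum_smul_eq ?_ ?_
      · rw [← Finset.mul_sum, hw1, inv_mul_cancel₀ hs0.ne']
      · rw [hw]; simp only [mul_smul, Finset.smul_sum]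
    have hiI : i ∈ I := by
      by_contra hiI
      have := hwI i hiI
      rw [hwa] at this
      exact (mul_ne_zero (inv_ne_zero hs0.ne') hi) this
    exact Set.image_subset_range _ _ (hsub (Set.mem_image_of_mem _ hiI))

/-! ### The classical Sperner lemma. -/

/-- **Sperner's lemma**: a proper labeling of a simplicial subdivision of a simplex has a
completely labeled member. -/
theorem exists_injective_labeling {V : Type*} [AddCommGroup V] [Module ℝ V] {d : ℕ}
    {S : Affine.Simplex ℝ V d} {𝒯 : Set (Affine.Simplex ℝ V d)}
    (h𝒯 : IsSimplicialSubdivision S 𝒯) (ℓ : V → Fin (d + 1))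
    (hℓ : ∀ T ∈ 𝒯, ∀ j, ∀ w : Fin (d + 1) → ℝ, 0 ≤ w → ∑ i, w i = 1 →
      T.points j = ∑ i, w i • S.points i → w (ℓ (T.points j)) ≠ 0) :
    ∃ T ∈ 𝒯, Function.Injective fun j => ℓ (T.points j) := by
  classical
  -- Members of `𝒯` carry an ordering of their vertices. Keeping one per vertex set prevents the
  -- same simplex from being counted twice, which would violate the negligible overlaps.
  obtain ⟨𝒯₀, hsub, hbij⟩ := Set.exists_subset_bijOn 𝒯
    fun T : Affine.Simplex ℝ V d => Set.range T.points
  have hfin : Finite 𝒯₀ := h𝒯.finite.subset hsub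
  have hcover : ∀ x ∈ convexHull ℝ (Set.range S.points),
      ∃ T : 𝒯₀, x ∈ convexHull ℝ (Set.range T.1.points) := by
    intro x hx
    rw [h𝒯.cover] at hx
    obtain ⟨T, hT, hxT⟩ := Set.mem_iUnion₂.1 hx
    obtain ⟨T₀, hT₀, he⟩ := hbij.surjOn (Set.mem_image_of_mem _ hT)
    exact ⟨⟨T₀, hT₀⟩, by simpa only [he] using hxT⟩
  have hW : ∀ (T : 𝒯₀) (j : Fin (d + 1)), ∃ w : Fin (d + 1) → ℝ, 0 ≤ w ∧ ∑ i, w i = 1 ∧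
      ∑ i, w i • S.points i = T.1.points j := by
    intro T j
    refine exists_weights_of_mem_convexHull_range ?_
    rw [h𝒯.cover]
    exact Set.mem_iUnion₂.2 ⟨T.1, hsub T.2, subset_convexHull ℝ _ (Set.mem_range_self j)⟩
  choose W hW0 hW1 hWS using hW
  have hWℓ : ∀ T j, W T j (ℓ (T.1.points j)) ≠ 0 := fun T j =>
    hℓ T.1 (hsub T.2) j (W T j) (hW0 T j) (hW1 T j) (hWS T j).symm
  -- `Mat T` converts homogeneous barycentric coordinates relative to `T` into those relative to
  -- `S`. Its inverse is `B T`, and `C T` is the cone over `T` in the coordinates of `S`.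
  let Mat : 𝒯₀ → (Fin (d + 1) → ℝ) →ₗ[ℝ] (Fin (d + 1) → ℝ) := fun T =>
    Fintype.linearCombination ℝ (W T)
  have hMat : ∀ T b i, Mat T b i = ∑ j, b j * W T j i := fun T b i => by
    simp [Mat, Fintype.linearCombination_apply]
  have hMsum : ∀ T b, ∑ i, Mat T b i = ∑ j, b j := fun T b => by
    simp only [hMat]
    rw [Finset.sum_comm]
    simp only [← Finset.mul_sum, hW1, mul_one]
  have hMS : ∀ T b, ∑ i, Mat T b i • S.points i = ∑ j, b j • T.1.points j := fun T b => by
    simp only [hMat, Finset.sum_smul, mul_smul]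
    rw [Finset.sum_comm]
    simp only [← Finset.smul_sum, hWS]
  have hMinj : ∀ T, Function.Injective (Mat T) := fun T a b hab =>
    T.1.independent.eq_of_sum_smul_eq (by rw [← hMsum, hab, hMsum])
      (by rw [← hMS, hab, hMS])
  let B : 𝒯₀ → (Fin (d + 1) → ℝ) ≃ₗ[ℝ] (Fin (d + 1) → ℝ) := fun T =>
    (LinearEquiv.ofInjectiveEndo (Mat T) (hMinj T)).symm
  have hMB : ∀ T x, Mat T (B T x) = x := fun T x =>
    (LinearEquiv.ofInjectiveEndo (Mat T) (hMinj T)).apply_symm_apply x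
  have hBM : ∀ T x, B T (Mat T x) = x := fun T x =>
    (LinearEquiv.ofInjectiveEndo (Mat T) (hMinj T)).symm_apply_apply x
  have hBsum : ∀ T x, ∑ j, B T x j = ∑ i, x i := fun T x => by rw [← hMsum T, hMB]
  have hBS : ∀ T x, ∑ j, B T x j • T.1.points j = ∑ i, x i • S.points i := fun T x => by
    rw [← hMS T, hMB]
  let C : 𝒯₀ → Set (Fin (d + 1) → ℝ) := fun T => {x | 0 ≤ B T x}
  let N : V → Fin (d + 1) → ℝ := fun v => Pi.single (ℓ v) 1
  -- The linear map sending the coordinate vector of each vertex of `T` to the unit vector of its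
  -- label; two equal labels would make it singular.
  let H : 𝒯₀ → (Fin (d + 1) → ℝ) →ₗ[ℝ] (Fin (d + 1) → ℝ) := fun T =>
    Fintype.linearCombination ℝ (fun j => N (T.1.points j)) ∘ₗ (B T).toLinearMap
  have hH : ∀ T x, H T x = ∑ j, B T x j • N (T.1.points j) := fun T x => by
    simp [H, Fintype.linearCombination_apply]
  have hrange : ∀ T T' : 𝒯₀, ∀ x ∈ C T, x ∈ C T' → ∀ i, B T x i ≠ 0 →
      T.1.points i ∈ Set.range T'.1.points := fun T T' x hx hx' =>
    mem_range_of_sum_smul_eq (h𝒯.inter T.1 (hsub T.2) T'.1 (hsub T'.2)) hx hx'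
      (by rw [hBsum, hBsum]) (by rw [hBS, hBS])
  have hpos : ∀ T, ∀ x ∈ C T, 0 ≤ x := fun T x hx i => by
    rw [← hMB T x, hMat]
    exact Finset.sum_nonneg fun j _ => mul_nonneg (hx j) (hW0 T j i)
  obtain ⟨T, hT⟩ := exists_det_ne_zero_of_piecewise_linear (C := C) (H := H)
    (fun T => isClosed_Ici.preimage (B T).toLinearMap.continuous_of_finiteDimensional) hpos
    (by
      intro x hx
      -- The origin lies in every cone; any other point is scaled to total mass one and located in a
      -- member of the subdivision.
      rcases (Finset.sum_nonneg fun i (_ : i ∈ Finset.univ) => hx i).eq_or_lt with h0 | h0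
      · have hx0 : x = 0 := funext fun i =>
          (Finset.sum_eq_zero_iff_of_nonneg fun i _ => hx i).1 h0.symm i (Finset.mem_univ i)
        obtain ⟨T, -⟩ := hcover (S.points 0) (subset_convexHull ℝ _ (Set.mem_range_self 0))
        exact ⟨T, by simp [C, hx0]⟩
      · set s := ∑ i, x i with hs
        obtain ⟨T, hT⟩ := hcover (∑ i, (s⁻¹ * x i) • S.points i)
          (mem_convexHull_of_exists_fintype (fun i => s⁻¹ * x i) S.points
            (fun i => mul_nonneg (inv_nonneg.2 h0.le) (hx i))
            (by rw [← Finset.mul_sum, inv_mul_cancel₀ h0.ne'])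
            (fun i => Set.mem_range_self i) rfl)
        obtain ⟨b, hb0, hb1, hb⟩ := exists_weights_of_mem_convexHull_range hT
        refine ⟨T, ?_⟩
        have e : x = Mat T (s • b) := by
          refine S.independent.eq_of_sum_smul_eq ?_ ?_
          · simp [hMsum, ← Finset.mul_sum, hb1, ← hs]
          · rw [hMS]
            simp only [Pi.smul_apply, smul_eq_mul, mul_smul]
            rw [← Finset.smul_sum, hb]
            simp only [mul_smul, ← Finset.smul_sum, smul_inv_smul₀ h0.ne']
        change 0 ≤ B T x
        rw [e, hBM]
        exact smul_nonneg h0.le hb0)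
    (by
      intro T T' x hx hx'
      rw [hH, hH]
      exact T'.1.independent.sum_smul_comp_eq (hrange T T' x hx hx') (by rw [hBsum, hBsum])
        (by rw [hBS, hBS]) N)
    (by
      intro T x
      rw [← hBsum T x]
      simp only [hH, Finset.sum_apply, Pi.smul_apply, smul_eq_mul]
      rw [Finset.sum_comm]
      simp [← Finset.mul_sum, N])
    (by
      intro T x hx
      rw [hH]
      exact Finset.sum_nonneg fun j _ =>
        smul_nonneg (hx j) (Pi.single_nonneg.2 zero_le_one))
    (by
      intro T x hx i hi
      rw [← hMB T x, hMat, Finset.sum_eq_zero_iff_of_nonneg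
        fun j _ => mul_nonneg (hx j) (hW0 T j i)] at hi
      rw [hH, Finset.sum_apply]
      -- A vertex labeled `i` has nonzero `i`-th coordinate, so it cannot carry weight at a point
      -- whose `i`-th coordinate is zero.
      refine Finset.sum_eq_zero fun j hj => ?_
      by_cases hji : ℓ (T.1.points j) = i
      · have := (mul_eq_zero.1 (hi j hj)).resolve_right (hji ▸ hWℓ T j)
        simp [this]
      · simp [N, Pi.single_eq_of_ne (Ne.symm hji)])
    (by
      intro T T' hTT'
      -- Some vertex of `T` is not a vertex of `T'`. Its coordinate vanishes on the overlap of the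
      -- cones, which therefore lies in a hyperplane.
      obtain ⟨i, hi⟩ : ∃ i, T.1.points i ∉ Set.range T'.1.points := by
        by_contra hcon
        push Not at hcon
        refine hTT' (Subtype.ext (hbij.injOn T.2 T'.2 ?_))
        refine Set.eq_of_subset_of_ncard_le (Set.range_subset_iff.2 hcon) ?_ (Set.toFinite _)
        rw [Set.ncard_range_of_injective T'.1.independent.injective,
          Set.ncard_range_of_injective T.1.independent.injective]
      let Z : Submodule ℝ (Fin (d + 1) → ℝ) :=
        LinearMap.ker (LinearMap.proj i ∘ₗ (B T).toLinearMap)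
      refine measure_mono_null (t := Z) (fun x hx => ?_) (Measure.addHaar_submodule _ Z ?_)
      · by_contra hne
        exact hi (hrange T T' x hx.1 hx.2 i fun h => hne (by simpa [Z] using h))
      · intro htop
        have : Mat T (Pi.single i 1) ∈ Z := htop ▸ Submodule.mem_top
        simp [Z, hBM] at this)
  refine ⟨T.1, hsub T.2, fun j j' hjj' => ?_⟩
  have hinj : Function.Injective (H T) :=
    LinearMap.ker_eq_bot.1 (by
      by_contra hker
      exact hT (LinearMap.det_eq_zero_iff_ker_ne_bot.2 hker))
  have e : H T (Mat T (Pi.single j 1)) = H T (Mat T (Pi.single j' 1)) := by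
    simp only [hH, hBM, N]
    simp only [Pi.single_apply, ite_smul, one_smul, zero_smul, Finset.sum_ite_eq',
      Finset.mem_univ, if_true]
    simp only at hjj'
    rw [hjj']
  have := congrFun (hMinj T (hinj e)) j
  by_contra hne
  simp [Pi.single_eq_of_ne hne] at this

/-! ### Real scalars and order in `L⁰`. -/

namespace RandomSperner

section RingL0

variable {Ω : Type*} [MeasurableSpace Ω] {P : Measure Ω} {𝕜 : Type*} [RCLike 𝕜]

theorem coeFn_ofRealL0 (ξ : Ω →ₘ[P] ℝ) : ⇑(ofRealL0 𝕜 ξ) =ᵐ[P] fun ω => (ξ ω : 𝕜) :=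
  AEEqFun.coeFn_comp _ _ _

variable (P 𝕜) in
/-- The inclusion of `L⁰(𝓕, ℝ)` into `L⁰(𝓕, 𝕜)` as a ring homomorphism. -/
noncomputable def ofRealL0Hom : (Ω →ₘ[P] ℝ) →+* (Ω →ₘ[P] 𝕜) where
  toFun := ofRealL0 𝕜
  map_one' := AEEqFun.ext <| by
    filter_upwards [coeFn_ofRealL0 (𝕜 := 𝕜) (1 : Ω →ₘ[P] ℝ), AEEqFun.coeFn_one (μ := P) (β := ℝ),
      AEEqFun.coeFn_one (μ := P) (β := 𝕜)] with ω h1 h2 h3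
    simp [h1, h2, h3]
  map_zero' := AEEqFun.ext <| by
    filter_upwards [coeFn_ofRealL0 (𝕜 := 𝕜) (0 : Ω →ₘ[P] ℝ), AEEqFun.coeFn_zero (μ := P) (β := ℝ),
      AEEqFun.coeFn_zero (μ := P) (β := 𝕜)] with ω h1 h2 h3
    simp [h1, h2, h3]
  map_add' ξ η := AEEqFun.ext <| by
    filter_upwards [coeFn_ofRealL0 (𝕜 := 𝕜) (ξ + η), AEEqFun.coeFn_add ξ η,
      AEEqFun.coeFn_add (ofRealL0 𝕜 ξ) (ofRealL0 𝕜 η), coeFn_ofRealL0 (𝕜 := 𝕜) ξ,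
      coeFn_ofRealL0 (𝕜 := 𝕜) η] with ω h1 h2 h3 h4 h5
    simp [h1, h2, h3, h4, h5]
  map_mul' ξ η := AEEqFun.ext <| by
    filter_upwards [coeFn_ofRealL0 (𝕜 := 𝕜) (ξ * η), AEEqFun.coeFn_mul ξ η,
      AEEqFun.coeFn_mul (ofRealL0 𝕜 ξ) (ofRealL0 𝕜 η), coeFn_ofRealL0 (𝕜 := 𝕜) ξ,
      coeFn_ofRealL0 (𝕜 := 𝕜) η] with ω h1 h2 h3 h4 h5
    simp [h1, h2, h3, h4, h5]

theorem ofRealL0Hom_apply (ξ : Ω →ₘ[P] ℝ) : ofRealL0Hom P 𝕜 ξ = ofRealL0 𝕜 ξ := rfl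

theorem ofRealL0Hom_injective : Function.Injective (ofRealL0Hom (Ω := Ω) P 𝕜) := by
  intro ξ η h
  refine AEEqFun.ext ?_
  filter_upwards [coeFn_ofRealL0 (𝕜 := 𝕜) ξ, coeFn_ofRealL0 (𝕜 := 𝕜) η] with ω h1 h2
  rw [ofRealL0Hom_apply, ofRealL0Hom_apply] at h
  rw [h, h2] at h1
  exact RCLike.ofReal_injective h1.symm

theorem nonneg_iff_ae {ξ : Ω →ₘ[P] ℝ} : 0 ≤ ξ ↔ ∀ᵐ ω ∂P, 0 ≤ ξ ω := by
  rw [← AEEqFun.coeFn_le]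
  refine eventually_congr ?_
  filter_upwards [AEEqFun.coeFn_zero (μ := P) (β := ℝ)] with ω h
  simp [h]

theorem add_nonneg_L0 {ξ η : Ω →ₘ[P] ℝ} (hξ : 0 ≤ ξ) (hη : 0 ≤ η) : 0 ≤ ξ + η := by
  rw [nonneg_iff_ae] at *
  filter_upwards [hξ, hη, AEEqFun.coeFn_add ξ η] with ω h1 h2 h3
  rw [h3]
  exact add_nonneg h1 h2

theorem mul_nonneg_L0 {ξ η : Ω →ₘ[P] ℝ} (hξ : 0 ≤ ξ) (hη : 0 ≤ η) : 0 ≤ ξ * η := by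
  rw [nonneg_iff_ae] at *
  filter_upwards [hξ, hη, AEEqFun.coeFn_mul ξ η] with ω h1 h2 h3
  rw [h3]
  exact mul_nonneg h1 h2

theorem sum_nonneg_L0 {ι : Type*} (s : Finset ι) {ξ : ι → Ω →ₘ[P] ℝ} (hξ : ∀ i ∈ s, 0 ≤ ξ i) :
    0 ≤ ∑ i ∈ s, ξ i :=
  Finset.sum_induction ξ (0 ≤ ·) (fun _ _ => add_nonneg_L0) le_rfl hξ

theorem zero_le_one_L0 : (0 : Ω →ₘ[P] ℝ) ≤ 1 := by
  rw [nonneg_iff_ae]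
  filter_upwards [AEEqFun.coeFn_one (μ := P) (β := ℝ)] with ω h
  simp [h]

theorem zero_smul_L0 {E : Type*} [AddCommGroup E] [Module (Ω →ₘ[P] 𝕜) E] (x : E) :
    (0 : Ω →ₘ[P] 𝕜) • x = 0 :=
  zero_smul (Ω →ₘ[P] 𝕜) x

end RingL0

/-! ### Partitions and their indicators. -/

namespace MeasurablePartition

variable {Ω : Type*} [MeasurableSpace Ω] {ι : Type*} (a : MeasurablePartition Ω ι)
  (P : Measure Ω) (𝕜 : Type*) [RCLike 𝕜]

theorem coeFn_ind (i : ι) : ⇑(a.ind P 𝕜 i) =ᵐ[P] (a.sets i).indicator fun _ => (1 : 𝕜) :=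
  AEEqFun.coeFn_mk _ _

theorem ind_nonneg (i : ι) : 0 ≤ a.ind P ℝ i := by
  rw [nonneg_iff_ae]
  filter_upwards [a.coeFn_ind P ℝ i] with ω h
  rw [h]
  exact Set.indicator_nonneg (fun _ _ => zero_le_one) ω

theorem ofRealL0_ind (i : ι) : ofRealL0 𝕜 (a.ind P ℝ i) = a.ind P 𝕜 i := by
  refine AEEqFun.ext ?_
  filter_upwards [coeFn_ofRealL0 (𝕜 := 𝕜) (a.ind P ℝ i), a.coeFn_ind P ℝ i, a.coeFn_ind P 𝕜 i]
    with ω h1 h2 h3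
  rw [h1, h2, h3]
  by_cases h : ω ∈ a.sets i <;> simp [h]

theorem ind_mul_self (i : ι) : a.ind P 𝕜 i * a.ind P 𝕜 i = a.ind P 𝕜 i := by
  refine AEEqFun.ext ?_
  filter_upwards [AEEqFun.coeFn_mul (a.ind P 𝕜 i) (a.ind P 𝕜 i), a.coeFn_ind P 𝕜 i] with ω h1 h2
  rw [h1, Pi.mul_apply, h2]
  by_cases h : ω ∈ a.sets i <;> simp [h]

theorem ind_mul_of_ne {i j : ι} (hij : i ≠ j) : a.ind P 𝕜 i * a.ind P 𝕜 j = 0 := by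
  refine AEEqFun.ext ?_
  filter_upwards [AEEqFun.coeFn_mul (a.ind P 𝕜 i) (a.ind P 𝕜 j), a.coeFn_ind P 𝕜 i,
    a.coeFn_ind P 𝕜 j, AEEqFun.coeFn_zero (μ := P) (β := 𝕜)] with ω h1 h2 h3 h4
  rw [h1, Pi.mul_apply, h2, h3, h4]
  by_cases h : ω ∈ a.sets i
  · simp [Set.disjoint_left.1 (a.disjoint hij) h]
  · simp [h]

theorem coeFn_sum {Ω ι : Type*} [MeasurableSpace Ω] {P : Measure Ω} {R : Type*}
    [TopologicalSpace R] [CommRing R] [IsTopologicalRing R] (s : Finset ι) (f : ι → Ω →ₘ[P] R) :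
    ⇑(∑ i ∈ s, f i) =ᵐ[P] fun ω => ∑ i ∈ s, f i ω := by
  classical
  induction s using Finset.induction_on with
  | empty =>
    filter_upwards [AEEqFun.coeFn_zero (μ := P) (β := R)] with ω h
    exact h
  | insert i s hi ih =>
    rw [Finset.sum_insert hi]
    filter_upwards [AEEqFun.coeFn_add (f i) (∑ i ∈ s, f i), ih] with ω h1 h2
    rw [h1, Pi.add_apply, h2, Finset.sum_insert hi]

theorem sum_ind [Fintype ι] : ∑ i, a.ind P 𝕜 i = 1 := by
  refine AEEqFun.ext ?_
  filter_upwards [coeFn_sum Finset.univ (a.ind P 𝕜), eventually_all.2 (a.coeFn_ind P 𝕜),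
    AEEqFun.coeFn_one (μ := P) (β := 𝕜)] with ω h1 h2 h3
  rw [h1, h3]
  simp only [h2]
  obtain ⟨i, hi⟩ := Set.mem_iUnion.1 (a.cover.symm ▸ Set.mem_univ ω : ω ∈ ⋃ i, a.sets i)
  rw [Finset.sum_eq_single i]
  · simp [hi]
  · intro j _ hj
    exact Set.indicator_of_notMem (Set.disjoint_left.1 (a.disjoint hj.symm) hi) _
  · simp

theorem ind_smul_sum_ind_smul [Fintype ι] {E : Type*} [AddCommGroup E] [Module (Ω →ₘ[P] 𝕜) E]
    (z : ι → E) (i : ι) : a.ind P 𝕜 i • ∑ k, a.ind P 𝕜 k • z k = a.ind P 𝕜 i • z i := by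
  rw [Finset.smul_sum, Finset.sum_eq_single i]
  · rw [smul_smul, ind_mul_self]
  · intro k _ hk
    rw [smul_smul, a.ind_mul_of_ne P 𝕜 hk.symm, zero_smul_L0]
  · simp

/-- Regard a nonempty finite partition as a sequence, padded with empty sets. -/
def toNat {M : ℕ} (a : MeasurablePartition Ω (Fin M)) : MeasurablePartition Ω ℕ where
  sets k := if h : k < M then a.sets ⟨k, h⟩ else ∅
  measurable k := by
    split_ifs with h
    exacts [a.measurable _, MeasurableSet.empty]
  disjoint k l hkl := by
    by_cases hk : k < M <;> by_cases hl : l < M <;> simp only [hk, hl, dif_pos, dif_neg,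
      not_false_iff, Set.disjoint_empty, Set.empty_disjoint]
    exact a.disjoint fun h => hkl (congrArg Fin.val h)
  cover := by
    refine Set.eq_univ_of_forall fun ω => ?_
    obtain ⟨i, hi⟩ := Set.mem_iUnion.1 (a.cover.symm ▸ Set.mem_univ ω : ω ∈ ⋃ i, a.sets i)
    exact Set.mem_iUnion.2 ⟨i, by simpa using hi⟩

theorem toNat_sets {M : ℕ} (a : MeasurablePartition Ω (Fin M)) (m : Fin M) :
    a.toNat.sets m = a.sets m := by
  simp [toNat]

/-- The concatenation along a finite partition is one along the padded partition, whatever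
members are chosen on the padding. -/
theorem isConcat_toNat {M : ℕ} (a : MeasurablePartition Ω (Fin M)) {E : Type*} [AddCommGroup E]
    [Module (Ω →ₘ[P] 𝕜) E] (z : Fin M → E) {f : ℕ → Fin M} (hf : ∀ m : Fin M, f m = m) :
    IsConcat P 𝕜 a.toNat (fun k => z (f k)) (∑ m, a.ind P 𝕜 m • z m) := by
  intro k
  by_cases hk : k < M
  · have h1 : a.toNat.ind P 𝕜 k = a.ind P 𝕜 ⟨k, hk⟩ := by
      refine AEEqFun.ext ?_
      filter_upwards [a.toNat.coeFn_ind P 𝕜 k, a.coeFn_ind P 𝕜 ⟨k, hk⟩] with ω h1 h2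
      rw [h1, h2, ← a.toNat_sets]
    rw [h1, ind_smul_sum_ind_smul]
    change _ = a.ind P 𝕜 ⟨k, hk⟩ • z (f (⟨k, hk⟩ : Fin M))
    rw [hf]
  · have h1 : a.toNat.ind P 𝕜 k = 0 := by
      refine AEEqFun.ext ?_
      filter_upwards [a.toNat.coeFn_ind P 𝕜 k, AEEqFun.coeFn_zero (μ := P) (β := 𝕜)] with ω h1 h2
      rw [h1, h2]
      simp [toNat, hk]
    rw [h1, zero_smul_L0, zero_smul_L0]

/-- A finite measurable family covering almost everything can be refined to a partition, up to
the exceptional set. -/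
theorem exists_subset_union_compl {M : ℕ} [NeZero M] (A : Fin M → Set Ω)
    (hA : ∀ m, MeasurableSet (A m)) :
    ∃ a : MeasurablePartition Ω (Fin M), ∀ m, a.sets m ⊆ A m ∪ (⋃ k, A k)ᶜ := by
  -- The uncovered set is added to every member so that `A'` covers all of `Ω`; each point then goes
  -- to the least index whose set contains it.
  let A' : Fin M → Set Ω := fun m => A m ∪ (⋃ k, A k)ᶜ
  have hA' : ∀ m, MeasurableSet (A' m) := fun m =>
    (hA m).union (MeasurableSet.iUnion hA).compl
  refine ⟨⟨fun m => A' m \ ⋃ k, ⋃ _ : k < m, A' k, fun m => ?_, ?_, ?_⟩, fun m => Set.sdiff_subset⟩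
  · exact (hA' m).diff (MeasurableSet.iUnion fun k => MeasurableSet.iUnion fun _ => hA' k)
  · intro k l hkl
    rw [Set.disjoint_left]
    rintro ω ⟨hk, hk'⟩ ⟨hl, hl'⟩
    rcases lt_or_gt_of_ne hkl with h | h
    · exact hl' (Set.mem_iUnion₂.2 ⟨k, h, hk⟩)
    · exact hk' (Set.mem_iUnion₂.2 ⟨l, h, hl⟩)
  · refine Set.eq_univ_of_forall fun ω => ?_
    have hex : ∃ m, ω ∈ A' m := by
      by_cases h : ω ∈ ⋃ k, A k
      · obtain ⟨m, hm⟩ := Set.mem_iUnion.1 h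
        exact ⟨m, Or.inl hm⟩
      · exact ⟨0, Or.inr h⟩
    obtain ⟨m, hm, hmin⟩ := WellFounded.has_min (wellFounded_lt (α := Fin M)) {m | ω ∈ A' m} hex
    refine Set.mem_iUnion.2 ⟨m, hm, fun h => ?_⟩
    obtain ⟨k, hk, hωk⟩ := Set.mem_iUnion₂.1 h
    exact hmin k hωk hk

end MeasurablePartition

end RandomSperner

/-! ### `L⁰`-convex hulls, extreme points and concatenation. -/

namespace RandomSperner

section Hull

variable {Ω : Type*} [MeasurableSpace Ω] {P : Measure Ω} {𝕜 : Type*} [RCLike 𝕜]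
  {E : Type*} [AddCommGroup E] [Module (Ω →ₘ[P] 𝕜) E]

theorem ofRealL0_sum {ι : Type*} (s : Finset ι) (ξ : ι → Ω →ₘ[P] ℝ) :
    ofRealL0 𝕜 (∑ i ∈ s, ξ i) = ∑ i ∈ s, ofRealL0 𝕜 (ξ i) :=
  map_sum (ofRealL0Hom P 𝕜) ξ s

theorem ofRealL0_add (ξ η : Ω →ₘ[P] ℝ) :
    ofRealL0 𝕜 (ξ + η) = ofRealL0 𝕜 ξ + ofRealL0 𝕜 η :=
  map_add (ofRealL0Hom P 𝕜) ξ η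

theorem ofRealL0_mul (ξ η : Ω →ₘ[P] ℝ) :
    ofRealL0 𝕜 (ξ * η) = ofRealL0 𝕜 ξ * ofRealL0 𝕜 η :=
  map_mul (ofRealL0Hom P 𝕜) ξ η

theorem ofRealL0_one : ofRealL0 𝕜 (1 : Ω →ₘ[P] ℝ) = 1 :=
  map_one (ofRealL0Hom P 𝕜)

theorem ofRealL0_zero : ofRealL0 𝕜 (0 : Ω →ₘ[P] ℝ) = 0 :=
  map_zero (ofRealL0Hom P 𝕜)

theorem one_smul_L0 (x : E) : (1 : Ω →ₘ[P] 𝕜) • x = x :=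
  one_smul (Ω →ₘ[P] 𝕜) x

/-- Elements of the `L⁰`-convex hull of a finite family are combinations of that family. -/
theorem mem_convL0_range_iff {ι : Type*} [Fintype ι] {p : ι → E} {y : E} :
    y ∈ convL0 P 𝕜 (Set.range p) ↔ ∃ ξ : ι → (Ω →ₘ[P] ℝ), (∀ i, 0 ≤ ξ i) ∧ ∑ i, ξ i = 1 ∧
      y = ∑ i, ofRealL0 𝕜 (ξ i) • p i := by
  classical
  constructor
  · rintro ⟨k, x, ξ, hx, hξ0, hξ1, rfl⟩
    choose σ hσ using hx
    refine ⟨fun i => ∑ j with σ j = i, ξ j, fun i => sum_nonneg_L0 _ fun j _ => hξ0 j, ?_, ?_⟩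
    · rw [← hξ1]
      exact Finset.sum_fiberwise _ _ _
    · rw [← Finset.sum_fiberwise (s := Finset.univ) (g := σ)]
      refine Finset.sum_congr rfl fun i _ => ?_
      rw [ofRealL0_sum, Finset.sum_smul]
      refine Finset.sum_congr rfl fun j hj => ?_
      rw [← hσ j, (Finset.mem_filter.1 hj).2]
  · rintro ⟨ξ, h0, h1, rfl⟩
    let e := Fintype.equivFin ι
    refine ⟨Fintype.card ι, p ∘ e.symm, ξ ∘ e.symm, fun i => Set.mem_range_self _,
      fun i => h0 _, ?_, ?_⟩
    · rw [← h1]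
      exact e.symm.sum_comp ξ
    · exact (e.symm.sum_comp fun i => ofRealL0 𝕜 (ξ i) • p i).symm

/-- Real barycentric coordinates with respect to `L⁰`-affinely independent points are unique. -/
theorem eq_of_sum_ofRealL0_smul_eq {ι : Type*} [Fintype ι] {p : ι → E}
    (hp : AffineIndependent (Ω →ₘ[P] 𝕜) p) {ξ η : ι → (Ω →ₘ[P] ℝ)} (h1 : ∑ i, ξ i = ∑ i, η i)
    (h2 : ∑ i, ofRealL0 𝕜 (ξ i) • p i = ∑ i, ofRealL0 𝕜 (η i) • p i) : ξ = η := by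
  have := hp.eq_of_sum_smul_eq (a := fun i => ofRealL0 𝕜 (ξ i)) (b := fun i => ofRealL0 𝕜 (η i))
    (by rw [← ofRealL0_sum, h1, ofRealL0_sum]) h2
  exact funext fun i => ofRealL0Hom_injective (congrFun this i)

/-- The vertexes of an `L⁰`-simplex are `L⁰`-extreme points. -/
theorem mem_extL0_of_affineIndependent {ι : Type*} [Fintype ι] {p : ι → E}
    (hp : AffineIndependent (Ω →ₘ[P] 𝕜) p) (j : ι) :
    p j ∈ extL0 P 𝕜 (convL0 P 𝕜 (Set.range p)) := by
  classical
  let δ : ι → (Ω →ₘ[P] ℝ) := fun i => if i = j then 1 else 0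
  have hδ1 : ∑ i, δ i = 1 := by
    have := Finset.sum_ite_eq' Finset.univ j fun _ => (1 : Ω →ₘ[P] ℝ)
    rw [if_pos (Finset.mem_univ j)] at this
    exact this
  have hδp : ∑ i, ofRealL0 𝕜 (δ i) • p i = p j := by
    rw [Finset.sum_eq_single j]
    · simp only [δ, if_true, ofRealL0_one, one_smul_L0]
    · intro i _ hi
      simp only [δ, if_neg hi, ofRealL0_zero, zero_smul_L0]
    · simp
  have hδ0 : ∀ i, 0 ≤ δ i := fun i => by
    by_cases hi : i = j
    · simp only [δ, if_pos hi, zero_le_one_L0]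
    · simp only [δ, if_neg hi, le_refl]
  refine ⟨Set.singleton_subset_iff.2 (mem_convL0_range_iff.2 ⟨δ, hδ0, hδ1, hδp.symm⟩), ?_⟩
  intro x hx y hy r hr hxy
  obtain ⟨ξ, hξ0, hξ1, rfl⟩ := mem_convL0_range_iff.1 hx
  obtain ⟨η, hη0, hη1, rfl⟩ := mem_convL0_range_iff.1 hy
  -- Uniqueness of coordinates transfers the convex combination to the coordinates. Off `j` two
  -- nonnegative terms add to zero while `r` and `1 - r` are a.s. positive, so `ξ` and `η` both
  -- vanish there.
  have key : (fun i => r * ξ i + (1 - r) * η i) = δ := by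
    refine eq_of_sum_ofRealL0_smul_eq hp ?_ ?_
    · rw [Finset.sum_add_distrib, ← Finset.mul_sum, ← Finset.mul_sum, hξ1, hη1, hδ1]
      exact (congrArg₂ (· + ·) (mul_one r) (mul_one (1 - r))).trans (add_sub_cancel r 1)
    · rw [hδp, ← Set.mem_singleton_iff.1 hxy, Finset.smul_sum, Finset.smul_sum,
        ← Finset.sum_add_distrib]
      refine Finset.sum_congr rfl fun i _ => ?_
      rw [ofRealL0_add, ofRealL0_mul, ofRealL0_mul, add_smul, mul_smul, mul_smul]
  have hzero : ∀ i, i ≠ j → ξ i = 0 ∧ η i = 0 := by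
    intro i hi
    have hi0 : r * ξ i + (1 - r) * η i = 0 := by
      have := congrFun key i
      simpa only [δ, if_neg hi] using this
    have hae : ∀ᵐ ω ∂P, ξ i ω = 0 ∧ η i ω = 0 := by
      filter_upwards [hr, nonneg_iff_ae.1 (hξ0 i), nonneg_iff_ae.1 (hη0 i),
        AEEqFun.coeFn_add (r * ξ i) ((1 - r) * η i), AEEqFun.coeFn_mul r (ξ i),
        AEEqFun.coeFn_mul (1 - r) (η i), AEEqFun.coeFn_sub 1 r,
        AEEqFun.coeFn_one (μ := P) (β := ℝ), AEEqFun.coeFn_zero (μ := P) (β := ℝ)]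
        with ω h1 h2 h3 h4 h5 h6 h7 h8 h9
      rw [hi0, h9, Pi.add_apply, h5, h6, Pi.mul_apply, Pi.mul_apply, h7, Pi.sub_apply, h8] at h4
      simp only [Pi.zero_apply, Pi.one_apply] at h4
      have e1 : 0 ≤ r ω * ξ i ω := mul_nonneg h1.1.le h2
      have e2 : 0 ≤ (1 - r ω) * η i ω := mul_nonneg (sub_nonneg.2 h1.2.le) h3
      have e3 : r ω * ξ i ω = 0 := by linarith
      have e4 : (1 - r ω) * η i ω = 0 := by linarith
      exact ⟨(mul_eq_zero.1 e3).resolve_left h1.1.ne',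
        (mul_eq_zero.1 e4).resolve_left (sub_pos.2 h1.2).ne'⟩
    constructor <;> refine AEEqFun.ext ?_ <;>
      filter_upwards [hae, AEEqFun.coeFn_zero (μ := P) (β := ℝ)] with ω h1 h2 <;> rw [h2]
    exacts [h1.1, h1.2]
  have hδ : ∀ ζ : ι → (Ω →ₘ[P] ℝ), (∀ i, i ≠ j → ζ i = 0) → ∑ i, ζ i = 1 → ζ = δ := by
    intro ζ h0 h1
    funext i
    by_cases hi : i = j
    · rw [Finset.sum_eq_single j (fun i _ hi => h0 i hi) (by simp)] at h1
      simp only [δ, hi, h1, if_true]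
    · simp only [δ, if_neg hi, h0 i hi]
  rw [hδ ξ (fun i hi => (hzero i hi).1) hξ1, hδ η (fun i hi => (hzero i hi).2) hη1, hδp]
  exact ⟨rfl, rfl⟩

variable {M d : ℕ} (a : MeasurablePartition Ω (Fin M))

/-- Concatenation along a finite partition preserves `L⁰`-affine independence. -/
theorem affineIndependent_concat {ι : Type*} {p : Fin M → ι → E}
    (hp : ∀ m, AffineIndependent (Ω →ₘ[P] 𝕜) (p m)) :
    AffineIndependent (Ω →ₘ[P] 𝕜) fun j => ∑ m, a.ind P 𝕜 m • p m j := by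
  rw [affineIndependent_iff]
  intro s w hw0 hw i hi
  -- Multiplication by the indicator localizes the relation to `p m`; the localized coefficients
  -- vanish, and their sum over `m` is `w i`.
  have key : ∀ m, a.ind P 𝕜 m * w i = 0 := by
    intro m
    refine affineIndependent_iff.1 (hp m) s (fun j => a.ind P 𝕜 m * w j) ?_ ?_ i hi
    · rw [← Finset.mul_sum, hw0, mul_zero]
    · have : a.ind P 𝕜 m • ∑ e ∈ s, w e • ∑ m, a.ind P 𝕜 m • p m e = 0 := by
        rw [hw, smul_zero]
      rw [← this, Finset.smul_sum]
      refine Finset.sum_congr rfl fun j _ => ?_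
      rw [smul_comm (a.ind P 𝕜 m), a.ind_smul_sum_ind_smul, smul_smul, mul_comm]
  calc w i = (∑ m, a.ind P 𝕜 m) * w i := by rw [a.sum_ind]; exact (one_mul (w i)).symm
    _ = 0 := by rw [Finset.sum_mul, Finset.sum_eq_zero fun m _ => key m]

/-- The concatenation of `L⁰`-convex hulls is the `L⁰`-convex hull of the concatenated
generators. -/
theorem concatSets_convL0_range {ι : Type*} [Fintype ι] (p : Fin M → ι → E) :
    concatSets P 𝕜 a (fun m => convL0 P 𝕜 (Set.range (p m))) =
      convL0 P 𝕜 (Set.range fun j => ∑ m, a.ind P 𝕜 m • p m j) := by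
  ext x
  rw [mem_convL0_range_iff]
  constructor
  · rintro ⟨z, hz, rfl⟩
    choose ξ hξ0 hξ1 hξ using fun m => mem_convL0_range_iff.1 (hz m)
    refine ⟨fun j => ∑ m, a.ind P ℝ m * ξ m j,
      fun j => sum_nonneg_L0 _ fun m _ => mul_nonneg_L0 (a.ind_nonneg P m) (hξ0 m j), ?_, ?_⟩
    · rw [Finset.sum_comm, ← a.sum_ind P ℝ]
      refine Finset.sum_congr rfl fun m _ => ?_
      rw [← Finset.mul_sum, hξ1]
      exact mul_one _
    · simp only [hξ, ofRealL0_sum, Finset.sum_smul]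
      rw [Finset.sum_comm]
      refine Finset.sum_congr rfl fun m _ => ?_
      rw [Finset.smul_sum]
      refine Finset.sum_congr rfl fun j _ => ?_
      rw [ofRealL0_mul, a.ofRealL0_ind, mul_comm, mul_smul, a.ind_smul_sum_ind_smul, smul_comm]
  · rintro ⟨ξ, hξ0, hξ1, rfl⟩
    -- The same coefficients serve on every member of the partition.
    refine ⟨fun m => ∑ j, ofRealL0 𝕜 (ξ j) • p m j,
      fun m => mem_convL0_range_iff.2 ⟨ξ, hξ0, hξ1, rfl⟩, ?_⟩
    simp only [Finset.smul_sum]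
    rw [Finset.sum_comm]
    exact Finset.sum_congr rfl fun j _ => Finset.sum_congr rfl fun m _ => smul_comm _ _ _

/-- The bridge from classical to random coordinates: real barycentric coordinates in the counterpart
become constant `L⁰` coordinates, to which properness applies. -/
theorem ofRealL0_const_smul [Module ℝ E] [IsScalarTower ℝ (Ω →ₘ[P] 𝕜) E] (r : ℝ) (x : E) :
    ofRealL0 𝕜 (AEEqFun.const Ω r : Ω →ₘ[P] ℝ) • x = r • x := by
  have h : ofRealL0 𝕜 (AEEqFun.const Ω r : Ω →ₘ[P] ℝ) = r • (1 : Ω →ₘ[P] 𝕜) := by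
    refine AEEqFun.ext ?_
    filter_upwards [coeFn_ofRealL0 (𝕜 := 𝕜) (AEEqFun.const Ω r : Ω →ₘ[P] ℝ),
      AEEqFun.coeFn_const (μ := P) Ω r, AEEqFun.coeFn_smul r (1 : Ω →ₘ[P] 𝕜),
      AEEqFun.coeFn_one (μ := P) (β := 𝕜)] with ω h1 h2 h3 h4
    rw [h1, h2, h3, Pi.smul_apply, h4, Function.const_apply, Pi.one_apply,
      RCLike.real_smul_eq_coe_mul, mul_one]
  rw [h, smul_assoc, one_smul_L0]

end Hull

end RandomSperner

/-! ### Sperner's lemma at almost every `ω`. -/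

namespace RandomSperner

section Labeling

variable {Ω : Type*} [MeasurableSpace Ω] {P : Measure Ω} {𝕜 : Type*} [RCLike 𝕜]
  {E : Type*} [AddCommGroup E] [Module (Ω →ₘ[P] 𝕜) E] {d : ℕ}

theorem points_mem_extL0 (T : Affine.Simplex (Ω →ₘ[P] 𝕜) E d) (j : Fin (d + 1)) :
    T.points j ∈ extL0 P 𝕜 (hullL0 T) :=
  mem_extL0_of_affineIndependent T.independent j

theorem points_mem_extFamilyL0 {𝒮 : Set (Affine.Simplex (Ω →ₘ[P] 𝕜) E d)}
    {T : Affine.Simplex (Ω →ₘ[P] 𝕜) E d} (hT : T ∈ 𝒮) (j : Fin (d + 1)) :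
    T.points j ∈ extFamilyL0 𝒮 := by
  -- Any partition serves, since a constant sequence is concatenated along it.
  obtain ⟨a, -⟩ := MeasurablePartition.exists_subset_union_compl (M := 1)
    (fun _ => (∅ : Set Ω)) fun _ => MeasurableSet.empty
  exact ⟨a.toNat, fun _ => T.points j,
    fun _ => Set.mem_iUnion₂.2 ⟨T, hT, points_mem_extL0 T j⟩, fun _ => rfl⟩

/-- For almost every `ω`, the labels at `ω` of the vertexes of some member of the subdivision are
pairwise distinct. -/
theorem ae_exists_injective_label [NeZero P] [Module ℝ E] [IsScalarTower ℝ (Ω →ₘ[P] 𝕜) E]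
    {S : Affine.Simplex (Ω →ₘ[P] 𝕜) E d} {𝒮 : Set (Affine.Simplex (Ω →ₘ[P] 𝕜) E d)}
    (h𝒮 : IsSimplicialSubdivisionL0 S 𝒮) {φ : extFamilyL0 𝒮 → (Ω →ₘ[P] Fin (d + 1))}
    (hφ : IsProperLabelingL0 S 𝒮 φ) :
    ∀ᵐ ω ∂P, ∃ T : 𝒮, Function.Injective fun j =>
      φ ⟨T.1.points j, points_mem_extFamilyL0 T.2 j⟩ ω := by
  classical
  have hfin : Finite 𝒮 := h𝒮.finite
  have hw : ∀ (T : 𝒮) (j : Fin (d + 1)), ∃ w : Fin (d + 1) → ℝ, 0 ≤ w ∧ ∑ i, w i = 1 ∧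
      ∑ i, w i • S.points i = T.1.points j := by
    intro T j
    refine exists_weights_of_mem_convexHull_range ?_
    change _ ∈ convexHull ℝ (Set.range (counterpart S).points)
    rw [h𝒮.counterpart.cover]
    exact Set.mem_iUnion₂.2 ⟨counterpart T.1, Set.mem_image_of_mem _ T.2,
      subset_convexHull ℝ _ (Set.mem_range_self j)⟩
  choose w hw0 hw1 hwS using hw
  have hproper : ∀ᵐ ω ∂P, ∀ (T : 𝒮) (j i : Fin (d + 1)),
      ¬ (φ ⟨T.1.points j, points_mem_extFamilyL0 T.2 j⟩ ω = i ∧ w T j i = 0) := by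
    refine eventually_all.2 fun T => eventually_all.2 fun j => eventually_all.2 fun i => ?_
    have h := hφ.proper ⟨T.1.points j, points_mem_extFamilyL0 T.2 j⟩
      (fun i => AEEqFun.const Ω (w T j i)) ?_ ?_ ?_ i
    · filter_upwards [h, AEEqFun.coeFn_const (μ := P) Ω (w T j i)] with ω h1 h2 h3
      exact h1 ⟨h3.1, by rw [h2, Function.const_apply, h3.2]⟩
    · intro i
      rw [nonneg_iff_ae]
      filter_upwards [AEEqFun.coeFn_const (μ := P) Ω (w T j i)] with ω h
      rw [h]
      exact hw0 T j i
    · refine AEEqFun.ext ?_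
      filter_upwards [MeasurablePartition.coeFn_sum Finset.univ
          fun i => (AEEqFun.const Ω (w T j i) : Ω →ₘ[P] ℝ),
        eventually_all.2 fun i => AEEqFun.coeFn_const (μ := P) Ω (w T j i),
        AEEqFun.coeFn_one (μ := P) (β := ℝ)] with ω h1 h2 h3
      rw [h1, h3, Pi.one_apply, ← hw1 T j]
      exact Finset.sum_congr rfl fun i _ => h2 i
    · simp only [ofRealL0_const_smul]
      exact (hwS T j).symm
  filter_upwards [hproper] with ω hω
  -- The labeling frozen at `ω`. The default value `0` is irrelevant, as only vertexes of members
  -- are evaluated.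
  let ℓ : E → Fin (d + 1) := fun v => if h : v ∈ extFamilyL0 𝒮 then φ ⟨v, h⟩ ω else 0
  have hℓ : ∀ (T : 𝒮) j, ℓ (T.1.points j) =
      φ ⟨T.1.points j, points_mem_extFamilyL0 T.2 j⟩ ω := fun T j =>
    dif_pos (points_mem_extFamilyL0 T.2 j)
  obtain ⟨_, ⟨T, hT, rfl⟩, hinj⟩ := exists_injective_labeling h𝒮.counterpart ℓ (by
    rintro _ ⟨T, hT, rfl⟩ j v hv0 hv1 hv hzero
    have e : v = w ⟨T, hT⟩ j := by
      refine (counterpart S).independent.eq_of_sum_smul_eq (hv1.trans (hw1 _ j).symm) ?_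
      rw [← hv]
      exact (hwS ⟨T, hT⟩ j).symm
    rw [e] at hzero
    exact hω ⟨T, hT⟩ j _ ⟨(hℓ ⟨T, hT⟩ j).symm, hzero⟩)
  refine ⟨⟨T, hT⟩, fun j j' hjj' => hinj ?_⟩
  change ℓ (T.points j) = ℓ (T.points j')
  rw [hℓ ⟨T, hT⟩ j, hℓ ⟨T, hT⟩ j']
  exact hjj'

end Labeling

end RandomSperner

/-! ### Gluing the pointwise solutions. -/

theorem mainTheorem1 {Ω : Type*} [MeasurableSpace Ω] (P : Measure Ω) [IsProbabilityMeasure P]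
    (𝕜 : Type*) [RCLike 𝕜]
    {E : Type*} [AddCommGroup E] [Module (Ω →ₘ[P] 𝕜) E]
    [Module ℝ E] [IsScalarTower ℝ (Ω →ₘ[P] 𝕜) E]
    (hE : IsRegularModule P 𝕜 E) {d : ℕ}
    (S : Affine.Simplex (Ω →ₘ[P] 𝕜) E d)
    (𝒮 : Set (Affine.Simplex (Ω →ₘ[P] 𝕜) E d))
    (h𝒮 : IsSimplicialSubdivisionL0 S 𝒮)
    (φ : extFamilyL0 𝒮 → (Ω →ₘ[P] Fin (d + 1)))
    (hφ : IsProperLabelingL0 S 𝒮 φ) :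
    ∃ (M : ℕ) (T : Fin M → Affine.Simplex (Ω →ₘ[P] 𝕜) E d)
      (y : Fin M → Fin (d + 1) → E) (a : MeasurablePartition Ω (Fin M))
      (G : Affine.Simplex (Ω →ₘ[P] 𝕜) E d),
      (∀ m, T m ∈ 𝒮) ∧
      (∀ m, ∃ π : Equiv.Perm (Fin (d + 1)), y m = (T m).points ∘ π) ∧
      (∀ j, G.points j = ∑ m, a.ind P 𝕜 m • y m j) ∧
      concatSets P 𝕜 a (fun m => hullL0 (T m)) = hullL0 G ∧
      IsCompletelyLabeledL0 S 𝒮 φ G ∧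
      ∀ j, ∃ hj : G.points j ∈ extFamilyL0 𝒮,
        φ ⟨G.points j, hj⟩ = AEEqFun.const Ω j := by
  classical
  have hlab := ae_exists_injective_label h𝒮 hφ
  have hfin : Finite 𝒮 := h𝒮.finite
  cases nonempty_fintype 𝒮
  -- The ordering that makes the `j`-th label equal to `j` depends on `ω`, so the pieces are indexed
  -- by members together with permutations; a member may occur several times.
  let κ := 𝒮 × Equiv.Perm (Fin (d + 1))
  let e : Fin (Fintype.card κ) ≃ κ := (Fintype.equivFin κ).symm
  set M := Fintype.card κ with hM
  have : (ae P).NeBot := ae_neBot.2 (NeZero.ne P)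
  have hne : NeZero M := by
    obtain ⟨ω, T, -⟩ := hlab.exists
    have : Nonempty κ := ⟨(T, 1)⟩
    exact ⟨Fintype.card_ne_zero⟩
  let T : Fin M → Affine.Simplex (Ω →ₘ[P] 𝕜) E d := fun m => (e m).1.1
  have hT : ∀ m, T m ∈ 𝒮 := fun m => (e m).1.2
  let y : Fin M → Fin (d + 1) → E := fun m => (T m).points ∘ (e m).2
  have hy : ∀ m j, y m j ∈ extFamilyL0 𝒮 := fun m j => points_mem_extFamilyL0 (hT m) _
  let A : Fin M → Set Ω := fun m => ⋂ j, {ω | φ ⟨y m j, hy m j⟩ ω = j}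
  have hA : ∀ m, MeasurableSet (A m) := fun m => MeasurableSet.iInter fun j =>
    (φ ⟨y m j, hy m j⟩).stronglyMeasurable.measurableSet_eq_fun stronglyMeasurable_const
  obtain ⟨a, ha⟩ := MeasurablePartition.exists_subset_union_compl A hA
  have hcov : ∀ᵐ ω ∂P, ω ∈ ⋃ m, A m := by
    filter_upwards [hlab] with ω ⟨T', hT'⟩
    -- Distinct labels form a bijection; its inverse picks for each `j` the vertex labeled `j` at
    -- `ω`.
    let π := (Equiv.ofBijective _ (Finite.injective_iff_bijective.1 hT')).symm
    refine Set.mem_iUnion.2 ⟨e.symm (T', π), Set.mem_iInter.2 fun j => ?_⟩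
    have h1 : φ ⟨T'.1.points (π j), points_mem_extFamilyL0 T'.2 _⟩ ω = j :=
      (Equiv.ofBijective _ (Finite.injective_iff_bijective.1 hT')).apply_symm_apply j
    have h2 : y (e.symm (T', π)) j = T'.1.points (π j) := by
      simp [y, T]
    simpa only [Set.mem_ofPred_eq, h2] using h1
  have hyind : ∀ m, AffineIndependent (Ω →ₘ[P] 𝕜) (y m) := fun m =>
    (T m).independent.comp_embedding (e m).2.toEmbedding
  let G : Affine.Simplex (Ω →ₘ[P] 𝕜) E d :=
    ⟨fun j => ∑ m, a.ind P 𝕜 m • y m j, affineIndependent_concat a hyind⟩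
  -- The value `0` beyond `M` is a filler: the padded partition is empty there.
  let f : ℕ → Fin M := fun k => if h : k < M then ⟨k, h⟩ else 0
  have hf : ∀ m : Fin M, f m = m := fun m => by simp [f]
  have hconcat : ∀ j, IsConcat P 𝕜 a.toNat (fun k => y (f k) j) (G.points j) := fun j =>
    a.isConcat_toNat P 𝕜 (fun m => y m j) hf
  have hG : ∀ j, G.points j ∈ extFamilyL0 𝒮 := fun j =>
    ⟨a.toNat, fun k => y (f k) j, fun k => Set.mem_iUnion₂.2
      ⟨T (f k), hT _, points_mem_extL0 (T (f k)) _⟩, hconcat j⟩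
  have hφG : ∀ j, φ ⟨G.points j, hG j⟩ = AEEqFun.const Ω j := by
    intro j
    refine AEEqFun.ext ?_
    have hlabel := hφ.labeling a.toNat (fun k => ⟨y (f k) j, hy (f k) j⟩) ⟨G.points j, hG j⟩
      (hconcat j)
    filter_upwards [ae_all_iff.2 hlabel, hcov, AEEqFun.coeFn_const (μ := P) Ω j] with ω h1 h2 h3
    obtain ⟨m, hm⟩ := Set.mem_iUnion.1 (a.cover.symm ▸ Set.mem_univ ω : ω ∈ ⋃ i, a.sets i)
    -- The exceptional part of `a.sets m` is excluded because the events cover almost every `ω`.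
    have hωA : ω ∈ A m := (ha m hm).resolve_right fun h => h h2
    rw [h3, h1 m (by rwa [a.toNat_sets])]
    have h4 : φ ⟨y m j, hy m j⟩ ω = j := Set.mem_iInter.1 hωA j
    simpa only [hf, Function.const_apply] using h4
  refine ⟨M, T, y, a, G, hT, fun m => ⟨(e m).2, rfl⟩, fun j => rfl, ?_, ⟨hφ, hG, ?_⟩,
    fun j => ⟨hG j, hφG j⟩⟩
  · have hrange : ∀ m, hullL0 (T m) = convL0 P 𝕜 (Set.range (y m)) := fun m => by
      rw [hullL0, EquivLike.range_comp]
    simp only [hrange]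
    exact concatSets_convL0_range a y
  · simp only [hφG]
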